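/- Let $n\ge 1$, and let $U=\{xz=y(y+t^n)\}\setminus\{yt=0\}$, an affine log Calabi--Yau 3-fold with tropicalisation $U^{\mathrm{trop}}$, whose underlying space is $N_{\mathbb R}=\mathbb R^3$ with $U^{\mathrm{trop}}(\mathbb Z)=\mathbb Z^3$. Let $\sigma\subset U^{\mathrm{trop}}$ be the cone $$\sigma=\{(a,b,c)\in\mathbb R^3 : a\ge 0,\ c\ge 0,\ a\le 2b,\ a\le b+nc\},$$ and let $d_1=(1,1,0)$, $d_2=(0,1,0)$, $d_3=(0,0,1)$ and $f_i=(i,i,1)$ for $i=1,\dots,n$; these are integral points of $\sigma$. Let $V$ be the mirror (Fock--Goncharov dual) cluster variety of $U$. Up to codimension two it is the union of two copies of the torus $\mathbb T^*=(\mathbb C^\times)^3_{u,v,w}$ glued by the wall-crossing automorphism $\theta_H(z^m)=z^m(1+u)^{-\langle m,(0,-1,n)\rangle}$, where $z^{(a,b,c)}=u^av^bw^c$. Thus $\mathbb C[V]$ consists of those Laurent polynomials in $u,v,w$ that are of the form $\theta_H(g)$ for a Laurent polynomial $g$. For $q\in U^{\mathrm{trop}}(\mathbb Z)$, the theta function $\vartheta_q$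 on $V$ is given, in the first torus chart, by the sum of the final monomials of all broken lines in $N_{\mathbb R}$ with asymptotic direction $q$ and endpoint a fixed basepoint $p=(p_1,p_2,p_3)\in\mathbb R^3$ with $p_2-np_3<0$, for the scattering diagram that consists of the single wall $H=(0,-1,n)^\perp$ with function $f_H=1+u$. (A broken line comes in from infinity along a ray parallel to $q$ that carries the monomial $z^q$; a piece that carries $c\,z^m$ is travelled with velocity $-m$; it may bend only at points of $H$, where $c\,z^m$ is replaced by a nonzero term, with exponent different from $m$, of $c\,z^m(1+u)^{|\langle m,(0,-1,n)\rangle|}$; and it ends at $p$.) Let $$R=\mathbb C[\vartheta_q : q\in\sigma\cap U^{\mathrm{trop}}(\mathbb Z)]$$ be the $\mathbb C$-algebra generated by the theta functions on $V$ indexed by the integral points of $\sigma$, and let $Y^*=\operatorname{Spec}R$. Write $\vartheta_i=\vartheta_{d_i}$ for $i=1,2,3$ and $\vartheta_{i+3}=\vartheta_{f_i}$ for $i=1,\dots,n$. **Theorem.** For each $q\in\mathbb Z^3$ there are only finitely many such broken lines, and $\vartheta_q\in\mathbb C[V]$. The ring $R$ is generated as a $\mathbb C$-algebra by $\vartheta_1,\dots,\vartheta_{n+3}$,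 and the morphism $(\vartheta_1,\dots,\vartheta_{n+3})\colon Y^*\to\mathbb A^{n+3}$ is an isomorphism of $Y^*$ onto the closed subscheme $\mathbb V(I)\subset\mathbb A^{n+3}$, where $I$ is the ideal of $\mathbb C[\vartheta_1,\dots,\vartheta_{n+3}]$ (polynomial ring) generated by the $2\times 2$ minors of the $2\times(n+1)$ matrix $$\begin{pmatrix}\vartheta_1+\vartheta_2&\vartheta_3&\vartheta_4&\cdots&\vartheta_{n+2}\\ \vartheta_1\vartheta_2&\vartheta_4&\vartheta_5&\cdots&\vartheta_{n+3}\end{pmatrix}.$$ The ideal $I$ has codimension (height) $n$. The affine scheme $Y^*$ is integral of dimension $3$, and the point $P^*\in Y^*$ over the origin of $\mathbb A^{n+3}$ is a nonisolated singular point: $Y^*$ is singular at $P^*$, and every neighbourhood of $P^*$ contains another singular point of $Y^*$. -/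

import Mathlib

open AlgebraicGeometry CategoryTheory Topology

noncomputable section

namespace FlopMirror

/-- The lattice `N = ℤ³`, which is the set of integral points `U^trop(ℤ)` of the tropicalisation
`U^trop` of `U = {xz = y(y + tⁿ)} ∖ {yt = 0}`, and the character lattice of the torus `𝕋*`. -/
abbrev N : Type := Fin 3 → ℤ

/-- The real space `N_ℝ = ℝ³` underlying `U^trop`. -/
abbrev NR : Type := Fin 3 → ℝ

/-- An integral point regarded as a point of `N_ℝ`. -/
def toReal (q : N) : NR := fun i => (q i : ℝ)

/-- The ring `ℂ[𝕋*] = ℂ[u^±, v^±, w^±]` of Laurent polynomials; the monomial `u^a v^b w^c` is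
`mono ![a, b, c]`. -/
abbrev Laurent : Type := AddMonoidAlgebra ℂ N

/-- The Laurent monomial with exponent `m`. -/
def mono (m : N) : Laurent := AddMonoidAlgebra.single m 1

/-- The scattering function `f_H = 1 + u` attached to the wall `H`. -/
def wallFunction : Laurent := 1 + mono ![1, 0, 0]

/-- The wall `H = (0, -1, n)^⊥` of the scattering diagram. -/
def wall (n : ℕ) : Set NR := {x | -x 1 + n * x 2 = 0}

/-- The pairing `⟨m, (0, -1, n)⟩` of an exponent with the primitive normal vector of `H`. -/
def pairing (n : ℕ) (m : N) : ℤ := -m 1 + n * m 2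

/-! ### The cluster variety `V`

Up to codimension two, `V` is the union of two copies of the torus `𝕋*` that are glued by the
wall crossing automorphism `θ_H (z^m) = z^m (1 + u)^{-⟨m, (0, -1, n)⟩}`. -/

/-- The ring `ℂ[𝕋*]` with `1 + u` inverted. -/
abbrev LaurentAway : Type := Localization.Away wallFunction

/-- `1 + u` as a unit of `LaurentAway`. -/
def wallUnit : LaurentAwayˣ :=
  (IsLocalization.Away.algebraMap_isUnit (S := LaurentAway) wallFunction).unit

/-- The wall crossing automorphism `θ_H`, defined on `ℂ[𝕋*]`. -/
def wallCrossing (n : ℕ) : Laurent →ₐ[ℂ] LaurentAway :=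
  AddMonoidAlgebra.lift ℂ LaurentAway N
    { toFun := fun m => algebraMap Laurent LaurentAway (mono m.toAdd) *
        ((wallUnit ^ (-pairing n m.toAdd) : LaurentAwayˣ) : LaurentAway)
      map_one' := by
        have h : mono (0 : N) = 1 := rfl
        simp [pairing, h]
      map_mul' := fun a b => by
        have h : mono (a.toAdd + b.toAdd) = mono a.toAdd * mono b.toAdd := by
          simp [mono, AddMonoidAlgebra.single_mul_single]
        have h2 : -pairing n (a.toAdd + b.toAdd) =
            -pairing n a.toAdd + -pairing n b.toAdd := by
          simp only [pairing, Pi.add_apply]; ring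
        rw [toAdd_mul, h, h2, zpow_add, map_mul, Units.val_mul]
        ring }

/-- The coordinate ring `ℂ[V]`, expressed in the first torus chart: the Laurent polynomials that
are also Laurent polynomials on the second torus chart. -/
def coordRingV (n : ℕ) : Subalgebra ℂ Laurent :=
  (wallCrossing n).range.comap (IsScalarTower.toAlgHom ℂ Laurent LaurentAway)

/-! ### Broken lines and theta functions -/

/-- A broken line in `N_ℝ`, for the scattering diagram that consists of the single wall
`(H, 1 + u)`, with endpoint `p` and asymptotic direction `q`.

It comes in from infinity along a ray `vertex 0 + ℝ_{≥0} q` that carries the monomial `z^q`. A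
segment (or ray) that carries the monomial `c z^m` is travelled with velocity `-m`. The bends occur
at points `vertex 0, …, vertex (bends - 1)` of the wall, and there a monomial `c z^m` is replaced
by a nonzero term, with an exponent other than `m`, of `c z^m (1 + u)^|⟨m, (0, -1, n)⟩|`. The last
vertex is the endpoint `p`. -/
structure BrokenLine (n : ℕ) (p : NR) (q : N) where
  /-- The number of bends. -/
  bends : ℕ
  /-- The bending points in the order in which they are passed, followed by the endpoint. -/
  vertex : Fin (bends + 1) → NR
  /-- The exponent carried by the domain of linearity that ends at the given vertex. -/
  exponent : Fin (bends + 1) → N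
  /-- The coefficient carried by the domain of linearity that ends at the given vertex. -/
  coeff : Fin (bends + 1) → ℂ
  exponent_zero : exponent 0 = q
  coeff_zero : coeff 0 = 1
  vertex_last : vertex (Fin.last bends) = p
  segment : ∀ i : Fin bends, ∃ s : ℝ, 0 < s ∧
    vertex i.succ = vertex i.castSucc - s • toReal (exponent i.succ)
  vertex_mem_wall : ∀ i : Fin bends, vertex i.castSucc ∈ wall n
  exponent_ne : ∀ i : Fin bends, exponent i.succ ≠ exponent i.castSucc
  coeff_ne_zero : ∀ i : Fin bends, coeff i.succ ≠ 0
  coeff_eq : ∀ i : Fin bends, coeff i.succ =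
    (AddMonoidAlgebra.single (exponent i.castSucc) (coeff i.castSucc) *
      wallFunction ^ (pairing n (exponent i.castSucc)).natAbs).coeff (exponent i.succ)

/-- The monomial carried by the last segment of a broken line. -/
def BrokenLine.lastMonomial {n : ℕ} {p : NR} {q : N} (γ : BrokenLine n p q) : Laurent :=
  AddMonoidAlgebra.single (γ.exponent (Fin.last γ.bends)) (γ.coeff (Fin.last γ.bends))

/-- The expansion, at the basepoint `p`, of the theta function `ϑ_q`: the sum over all broken lines
with endpoint `p` and asymptotic direction `q` of the monomial carried by the last segment. -/
def theta (n : ℕ) (p : NR) (q : N) : Laurent := ∑ᶠ γ : BrokenLine n p q, γ.lastMonomial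

/-! ### The cone and the mirror singularity -/

/-- The cone `σ ⊂ U^trop`, cut out in `N_ℝ` by the hyperplanes `(1, 0, 0)^⊥`, `(0, 0, 1)^⊥`,
`(1, -2, 0)^⊥` and `(1, -1, -n)^⊥`, on the side that contains `d₁`, `d₂`, `d₃`. -/
def cone (n : ℕ) : Set NR :=
  {x | 0 ≤ x 0 ∧ 0 ≤ x 2 ∧ x 0 - 2 * x 1 ≤ 0 ∧ x 0 - x 1 - n * x 2 ≤ 0}

/-- The integral points `d₁, d₂, d₃, f₁, f₂, f₃, …`, where `f_k = (k, k, 1)`. -/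
def point : ℕ → N
  | 0 => ![1, 1, 0]
  | 1 => ![0, 1, 0]
  | 2 => ![0, 0, 1]
  | k + 3 => ![(k : ℤ) + 1, (k : ℤ) + 1, 1]

theorem point_mem_cone (n : ℕ) (i : Fin (n + 3)) : toReal (point i) ∈ cone n := by
  obtain ⟨i, hi⟩ := i
  match i, hi with
  | 0, _ => simp [cone, toReal, point]
  | 1, _ => simp [cone, toReal, point]
  | 2, _ => simp [cone, toReal, point]
  | k + 3, hi =>
    have h : (k : ℝ) + 1 ≤ n := by
      have : k + 1 ≤ n := by omega
      exact_mod_cast this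
    have h0 : (0 : ℝ) ≤ k := k.cast_nonneg
    refine ⟨?_, ?_, ?_, ?_⟩ <;> simp [toReal, point] <;> linarith

/-- The ring `R = ℂ[ϑ_q : q ∈ σ ∩ U^trop(ℤ)]`. -/
def mirrorRing (n : ℕ) (p : NR) : Subalgebra ℂ Laurent :=
  Algebra.adjoin ℂ {f | ∃ q : N, toReal q ∈ cone n ∧ theta n p q = f}

/-- The mirror `Y* = Spec R`. -/
def mirror (n : ℕ) (p : NR) : Scheme.{0} := Spec (CommRingCat.of (mirrorRing n p))

/-- The coordinate ring of `𝔸^{n+3}`. The variable `X i` stands for `ϑ_{i+1}`. -/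
abbrev PolyRing (n : ℕ) : Type := MvPolynomial (Fin (n + 3)) ℂ

/-- Affine space `𝔸^{n+3}` over `ℂ`. -/
abbrev affineSpace (n : ℕ) : Scheme.{0} := Spec (CommRingCat.of (PolyRing n))

/-- The origin of `𝔸^{n+3}`. -/
def origin (n : ℕ) : affineSpace n :=
  (⟨RingHom.ker (MvPolynomial.constantCoeff : PolyRing n →+* ℂ), RingHom.ker_isPrime _⟩ :
    PrimeSpectrum (PolyRing n))

/-- The homomorphism from the polynomial ring to `R` that sends the variables to the theta functions
of `d₁, d₂, d₃, f₁, …, f_n`. -/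
def coordHom (n : ℕ) (p : NR) : PolyRing n →ₐ[ℂ] mirrorRing n p :=
  MvPolynomial.aeval fun i : Fin (n + 3) =>
    ⟨theta n p (point i), Algebra.subset_adjoin ⟨point i, point_mem_cone n i, rfl⟩⟩

/-- The morphism `Y* → 𝔸^{n+3}` whose coordinates are the theta functions of
`d₁, d₂, d₃, f₁, …, f_n`. -/
def coordMorphism (n : ℕ) (p : NR) : mirror n p ⟶ affineSpace n :=
  Spec.map (CommRingCat.ofHom (coordHom n p).toRingHom)

/-- The `2 × (n + 1)` matrix with rows `(ϑ₁ + ϑ₂, ϑ₃, …, ϑ_{n+2})` and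
`(ϑ₁ ϑ₂, ϑ₄, …, ϑ_{n+3})`. -/
def thetaMatrix (n : ℕ) : Matrix (Fin 2) (Fin (n + 1)) (PolyRing n) :=
  Matrix.of ![
    Fin.cons (MvPolynomial.X 0 + MvPolynomial.X 1)
      (fun j : Fin n => MvPolynomial.X ⟨j + 2, by omega⟩),
    Fin.cons (MvPolynomial.X 0 * MvPolynomial.X 1)
      (fun j : Fin n => MvPolynomial.X ⟨j + 3, by omega⟩)]

/-- The ideal `I` of the `2 × 2` minors of the matrix. -/
def minorIdeal (n : ℕ) : Ideal (PolyRing n) :=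
  Ideal.span {f | ∃ i j : Fin (n + 1), i < j ∧ ((thetaMatrix n).submatrix id ![i, j]).det = f}

/-- The closed subscheme `𝕍(I)` of `𝔸^{n+3}`. -/
def minorScheme (n : ℕ) : Scheme.{0} := Spec (CommRingCat.of (PolyRing n ⧸ minorIdeal n))

/-- The inclusion of `𝕍(I)` into `𝔸^{n+3}`. -/
def minorSchemeInclusion (n : ℕ) : minorScheme n ⟶ affineSpace n :=
  Spec.map (CommRingCat.ofHom (Ideal.Quotient.mk (minorIdeal n)))

/-- The singular locus of a scheme: the points whose local ring is not regular. -/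
def singularLocus (X : Scheme.{0}) : Set X :=
  {x | ¬ IsRegularLocalRing (X.presheaf.stalk x)}

end FlopMirror

end

/-!
The wall is the zero locus of the pairing with `(0, -1, n)`, and this pairing takes the same value
on all exponents of a broken line, since every bend adds a multiple of `(1, 0, 0)`. Hence a broken
line bends at most once, and only when it crosses the wall towards the basepoint. The possible
bends are the terms of a binomial expansion, so with `q = (a, b, c)`
`ϑ_q = u^a v^b w^c (1 + u)^max(0, b - n c)` (`theta_eq`).

Put `t = u v`, `A = ϑ₁ = t (1 + u)`, `B = ϑ₂ = v (1 + u)` and `w_i = ϑ_{i+3} = t^i w`, for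
`0 ≤ i ≤ n`. Then `A = u² v + t` and `B = v + t`, while `u² v · v = t²`. If `q` lies in the cone and
`b ≤ n c`, then `ϑ_q` is a product of `b` factors `u² v = A - t`, `t` and `v = B - t` and of `w^c`,
and `w^c t^j` is a product of the `w_i` for `j ≤ n c`. If `b > n c`, then the powers of `1 + u` can
be used up in factors `A` and `B`, with a cofactor of the first kind. This gives generation
(`mirrorRing_eq_adjoin`). In each column of the matrix the second entry is `t = A B / (A + B)` times
the first, so that the minors are relations.

That there are no further relations is shown by normal forms. Modulo the minors, a product of `c`
of the `w_i` depends only on `c` and on the sum `j` of the indices; call it `ω(c, j)`. The relation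
`A B ω(c, j) = (A + B) ω(c, j + 1)`, for `j < n c`, reduces every monomial to a combination of
`A^k B^l ω(c, j)` with `j = n c`, `k = 0` or `l = 0` (`span_normalForm_eq_top`). The Laurent
polynomials `u^(k+j) v^(k+l+j) w^c (1 + u)^(k+l)` that are the images of these are linearly
independent, by a triangularity argument on the extreme powers of `u`
(`linearIndependent_normalForm`). So the ideal of minors is the kernel of the map to the Laurent
ring, and in particular prime (`ker_laurentHom`).

For the dimensions, a chain of primes of length `n` below the ideal of minors is given by requiring
more and more of the `w_i` to be in geometric progression, a chain of length `3` in the quotient by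
explicit linear subspaces, and `ht I + dim (S / I) ≤ dim S = n + 3` shows that both are as long as
possible (`height_and_dim`).

A prime is singular if more elements of it than its height have independent differentials
(`not_isRegularLocalRing_of_tangent`). This holds at the point over the origin, where all minors
vanish to second order, and at the generic point of the line on which all coordinates but `ϑ₃`
vanish: there the scheme is a family of nodes `(ϑ₁ + ϑ₂) t = ϑ₁ ϑ₂`. The second point specialises to
the first, which is therefore not isolated among the singular points.
-/

open AlgebraicGeometry CategoryTheory Topology

noncomputable section

namespace FlopMirror

/-! ### Powers of the wall function -/

theorem single_mul_wallFunction_pow (m : N) (c : ℂ) (M : ℕ) :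
    (AddMonoidAlgebra.single m c : Laurent) * wallFunction ^ M =
      ∑ k ∈ Finset.range (M + 1),
        AddMonoidAlgebra.single (m + k • (![1, 0, 0] : N)) (c * (M.choose k : ℂ)) := by
  rw [wallFunction, add_comm, add_pow, Finset.mul_sum]
  refine Finset.sum_congr rfl fun k _ => ?_
  have h : ((M.choose k : ℕ) : Laurent) = AddMonoidAlgebra.single 0 (M.choose k : ℂ) := rfl
  simp [mono, AddMonoidAlgebra.single_pow, AddMonoidAlgebra.single_mul_single, h]

theorem mono_mul_mono (a b : N) : mono a * mono b = mono (a + b) := by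
  simp [mono, AddMonoidAlgebra.single_mul_single]

theorem mono_eq_one {a : N} (ha : a = 0) : mono a = 1 := by
  rw [ha]; rfl

theorem mono_pow (a : N) (k : ℕ) : mono a ^ k = mono (k • a) := by
  simp [mono, AddMonoidAlgebra.single_pow]

theorem exists_of_coeff_single_mul_wallFunction_pow_ne_zero (m m' : N) (c : ℂ) (M : ℕ)
    (h : (AddMonoidAlgebra.single m c * wallFunction ^ M : Laurent).coeff m' ≠ 0) :
    ∃ k ≤ M, m' = m + k • (![1, 0, 0] : N) := by
  rw [single_mul_wallFunction_pow] at h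
  contrapose! h
  rw [AddMonoidAlgebra.coeff_sum, Finsupp.finsetSum_apply]
  refine Finset.sum_eq_zero fun k hk => ?_
  rw [AddMonoidAlgebra.coeff_single, Finsupp.single_eq_of_ne]
  exact h k (by simpa [Nat.lt_succ_iff] using hk)

theorem coeff_single_mul_wallFunction_pow_add_smul (m : N) (c : ℂ) (M k : ℕ) :
    (AddMonoidAlgebra.single m c * wallFunction ^ M : Laurent).coeff
      (m + k • (![1, 0, 0] : N)) = c * (M.choose k : ℂ) := by
  rw [single_mul_wallFunction_pow, AddMonoidAlgebra.coeff_sum, Finsupp.finsetSum_apply]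
  rw [Finset.sum_eq_single k]
  · simp
  · intro b _ hb
    rw [AddMonoidAlgebra.coeff_single, Finsupp.single_eq_of_ne]
    intro h
    have := congrFun h 0
    simp at this
    exact hb this.symm
  · intro h
    have : M < k := by simpa using h
    simp [Nat.choose_eq_zero_of_lt this]

theorem pairing_add_smul (n : ℕ) (m : N) (k : ℕ) :
    pairing n (m + k • (![1, 0, 0] : N)) = pairing n m := by
  simp [pairing]

/-! ### Classification of the broken lines -/

/-- The real extension of the pairing with `(0, -1, n)`, whose zero locus is the wall. -/
def realPairing (n : ℕ) (x : NR) : ℝ := -x 1 + n * x 2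

theorem realPairing_toReal (n : ℕ) (m : N) : realPairing n (toReal m) = (pairing n m : ℝ) := by
  simp [realPairing, pairing, toReal]

theorem realPairing_sub_smul (n : ℕ) (x y : NR) (s : ℝ) :
    realPairing n (x - s • y) = realPairing n x - s * realPairing n y := by
  simp [realPairing]; ring

/-- The exponent of the power of `1 + u` from which a broken line with asymptotic direction `q`
chooses a term at the wall; it is `0` if such a line does not cross the wall towards the
basepoint. -/
def crossing (n : ℕ) (q : N) : ℕ := (-pairing n q).toNat

section
variable {n : ℕ} {p : NR} {q : N}

theorem BrokenLine.exponent_succ (γ : BrokenLine n p q) (i : Fin γ.bends) :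
    ∃ k : ℕ, k ≠ 0 ∧ k ≤ (pairing n (γ.exponent i.castSucc)).natAbs ∧
      γ.exponent i.succ = γ.exponent i.castSucc + k • (![1, 0, 0] : N) := by
  have h := γ.coeff_ne_zero i
  rw [γ.coeff_eq i] at h
  obtain ⟨k, hk, hk'⟩ := exists_of_coeff_single_mul_wallFunction_pow_ne_zero _ _ _ _ h
  refine ⟨k, ?_, hk, hk'⟩
  rintro rfl
  exact γ.exponent_ne i (by simpa using hk')

theorem BrokenLine.pairing_exponent (γ : BrokenLine n p q) (i : Fin (γ.bends + 1)) :
    pairing n (γ.exponent i) = pairing n q := by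
  induction i using Fin.induction with
  | zero => rw [γ.exponent_zero]
  | succ i ih =>
    obtain ⟨k, -, -, hk⟩ := γ.exponent_succ i
    rw [hk, pairing_add_smul, ih]

theorem BrokenLine.pairing_ne_zero (γ : BrokenLine n p q) (i : Fin γ.bends) :
    pairing n q ≠ 0 := by
  intro h
  obtain ⟨k, hk0, hk, -⟩ := γ.exponent_succ i
  rw [γ.pairing_exponent, h] at hk
  exact hk0 (by simpa using hk)

/-- A broken line bends at most once: between two bends it would travel inside the wall, with an
exponent that pairs to zero with the normal vector and so cannot change. -/
theorem BrokenLine.bends_le_one (γ : BrokenLine n p q) : γ.bends ≤ 1 := by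
  by_contra! h
  obtain ⟨s, hs, hv⟩ := γ.segment ⟨0, by omega⟩
  have h0 : realPairing n (γ.vertex (Fin.castSucc ⟨0, by omega⟩)) = 0 :=
    γ.vertex_mem_wall ⟨0, by omega⟩
  have h1 : realPairing n (γ.vertex (Fin.succ ⟨0, by omega⟩)) = 0 :=
    γ.vertex_mem_wall ⟨1, by omega⟩
  rw [hv, realPairing_sub_smul, h0, realPairing_toReal, γ.pairing_exponent] at h1
  have := γ.pairing_ne_zero ⟨0, by omega⟩
  have h2 : s * (pairing n q : ℝ) = 0 := by linarith
  rcases mul_eq_zero.1 h2 with h | h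
  · exact hs.ne' h
  · exact this (by exact_mod_cast h)

/-- The time that a broken line with exponent on the line `q + ℤ(1, 0, 0)` needs to travel from
the wall to the basepoint. -/
def travelTime (n : ℕ) (p : NR) (q : N) : ℝ := realPairing n p / -pairing n q

/-- The broken line with asymptotic direction `q` and last exponent `q + k (1, 0, 0)`. It is
straight for `k = 0` and bends once otherwise. -/
def line (n : ℕ) (p : NR) (hp : 0 < realPairing n p) (q : N) (k : Fin (crossing n q + 1)) :
    BrokenLine n p q :=
  if hk : (k : ℕ) = 0 then
    { bends := 0
      vertex := fun _ => p
      exponent := fun _ => q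
      coeff := fun _ => 1
      exponent_zero := rfl
      coeff_zero := rfl
      vertex_last := rfl
      segment := fun i => i.elim0
      vertex_mem_wall := fun i => i.elim0
      exponent_ne := fun i => i.elim0
      coeff_ne_zero := fun i => i.elim0
      coeff_eq := fun i => i.elim0 }
  else
    have hq : pairing n q < 0 := by
      by_contra! h
      have : crossing n q = 0 := by simp [crossing, h]
      omega
    have hq' : (pairing n q : ℝ) < 0 := by exact_mod_cast hq
    have hM : (pairing n q).natAbs = crossing n q := by unfold crossing; omega
    { bends := 1
      vertex := ![p + travelTime n p q • toReal (q + (k : ℕ) • (![1, 0, 0] : N)), p]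
      exponent := ![q, q + (k : ℕ) • (![1, 0, 0] : N)]
      coeff := ![1, ((crossing n q).choose k : ℂ)]
      exponent_zero := rfl
      coeff_zero := rfl
      vertex_last := rfl
      segment := fun i => by
        fin_cases i
        refine ⟨travelTime n p q, div_pos hp (by linarith), ?_⟩
        simp
      vertex_mem_wall := fun i => by
        fin_cases i
        change realPairing n (p + travelTime n p q • toReal (q + (k : ℕ) • (![1, 0, 0] : N))) = 0
        have h := realPairing_sub_smul n p (toReal (q + (k : ℕ) • (![1, 0, 0] : N)))
          (-travelTime n p q)
        rw [neg_smul, sub_neg_eq_add] at h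
        rw [h, realPairing_toReal, pairing_add_smul, travelTime]
        have hne : (pairing n q : ℝ) ≠ 0 := hq'.ne
        field_simp
        ring
      exponent_ne := fun i => by
        fin_cases i
        intro h
        have h' : q + (k : ℕ) • (![1, 0, 0] : N) = q := h
        have := congrFun h' 0
        simp at this
        exact hk (by simp [this])
      coeff_ne_zero := fun i => by
        fin_cases i
        have : (crossing n q).choose k ≠ 0 := (Nat.choose_pos (by omega)).ne'
        change ((crossing n q).choose k : ℂ) ≠ 0
        exact_mod_cast this
      coeff_eq := fun i => by
        fin_cases i
        change _ = (AddMonoidAlgebra.single q (1 : ℂ) *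
          wallFunction ^ (pairing n q).natAbs : Laurent).coeff (q + (k : ℕ) • (![1, 0, 0] : N))
        rw [coeff_single_mul_wallFunction_pow_add_smul, hM]
        simp }

theorem line_lastMonomial (hp : 0 < realPairing n p) (k : Fin (crossing n q + 1)) :
    (line n p hp q k).lastMonomial =
      AddMonoidAlgebra.single (q + (k : ℕ) • (![1, 0, 0] : N)) ((crossing n q).choose k : ℂ) := by
  unfold line
  split_ifs with hk
  · simp [BrokenLine.lastMonomial, hk]
  · rfl

theorem line_injective (hp : 0 < realPairing n p) : Function.Injective (line n p hp q) := by
  intro k l h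
  have h1 := congrArg BrokenLine.lastMonomial h
  have hc : ((crossing n q).choose k : ℂ) ≠ 0 := by
    have : (crossing n q).choose k ≠ 0 := (Nat.choose_pos (by omega)).ne'
    exact_mod_cast this
  rw [line_lastMonomial, line_lastMonomial, AddMonoidAlgebra.single_inj] at h1
  rcases h1 with h1 | h1
  · have := congrFun h1.1 0
    simp at this
    exact Fin.ext this
  · exact absurd h1.1 hc

/-- Every broken line is one of the lines `line n p hp q k`: with no bend it is determined by its
endpoint, and with one bend the last exponent determines the time spent after the bend. -/
theorem line_surjective (hp : 0 < realPairing n p) : Function.Surjective (line n p hp q) := by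
  intro γ
  have hb := γ.bends_le_one
  have hne := γ.pairing_ne_zero
  have hexp := γ.exponent_succ
  obtain ⟨bends, vertex, exponent, coeff, h1, h2, h3, h4, h5, h6, h7, h8⟩ := γ
  dsimp only at hb hne hexp
  interval_cases bends
  · refine ⟨0, ?_⟩
    have e1 : vertex = fun _ => p := by
      funext i; rw [← h3, Fin.fin_one_eq_zero i]; rfl
    have e2 : exponent = fun _ => q := by
      funext i; rw [← h1, Fin.fin_one_eq_zero i]
    have e3 : coeff = fun _ => 1 := by
      funext i; rw [← h2, Fin.fin_one_eq_zero i]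
    subst e1 e2 e3
    simp [line]
  · obtain ⟨k, hk0, hk, hk'⟩ := hexp 0
    obtain ⟨s, hs, hv⟩ := h4 0
    have hw : realPairing n (vertex 0) = 0 := h5 0
    have hq := hne 0
    have h8' := h8 0
    simp only [Fin.castSucc_zero, Fin.succ_zero_eq_one] at hk hk' hv h8'
    rw [h1] at hk hk' h8'
    have h3' : vertex 1 = p := h3
    have hp1 : realPairing n p = -(s * pairing n q) := by
      rw [← h3', hv, realPairing_sub_smul, hw, hk', realPairing_toReal, pairing_add_smul]
      ring
    have hneg : (pairing n q : ℝ) < 0 := by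
      by_contra! h
      have := mul_nonneg hs.le h
      linarith
    have hneg' : pairing n q < 0 := by exact_mod_cast hneg
    have hM : (pairing n q).natAbs = crossing n q := by unfold crossing; omega
    have hst : s = travelTime n p q := by
      rw [travelTime, hp1]
      field_simp
    rw [hM] at hk
    refine ⟨⟨k, by omega⟩, ?_⟩
    have e1 : vertex = ![p + travelTime n p q • toReal (q + k • (![1, 0, 0] : N)), p] := by
      funext i
      fin_cases i
      · change vertex 0 = p + _
        rw [← hst, ← h3', hv, hk']
        simp
      · exact h3'
    have e2 : exponent = ![q, q + k • (![1, 0, 0] : N)] := by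
      funext i
      fin_cases i
      · exact h1
      · exact hk'
    have e3 : coeff = ![1, ((crossing n q).choose k : ℂ)] := by
      funext i
      fin_cases i
      · exact h2
      · change coeff 1 = ((crossing n q).choose k : ℂ)
        rw [h8', h2, hk', coeff_single_mul_wallFunction_pow_add_smul, hM, one_mul]
    subst e1 e2 e3
    simp [line, hk0]

theorem finite_brokenLine (hp : 0 < realPairing n p) : Finite (BrokenLine n p q) :=
  Finite.of_surjective _ (line_surjective hp)

/-- The theta function `ϑ_q` is `z^q` if `q` lies on the side of the basepoint, and `z^q`
transported across the wall otherwise. -/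
theorem theta_eq (hp : 0 < realPairing n p) (q : N) :
    theta n p q = mono q * wallFunction ^ crossing n q := by
  have hb : Function.Bijective (line n p hp q) := ⟨line_injective hp, line_surjective hp⟩
  rw [mono, single_mul_wallFunction_pow, theta, ← finsum_comp_equiv (Equiv.ofBijective _ hb),
    finsum_eq_sum_of_fintype, Finset.sum_range]
  refine Finset.sum_congr rfl fun k _ => ?_
  rw [Equiv.ofBijective_apply, line_lastMonomial, one_mul]

end

/-! ### Theta functions on the cluster variety -/

theorem wallCrossing_mono (n : ℕ) (m : N) :
    wallCrossing n (mono m) = algebraMap Laurent LaurentAway (mono m) *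
      ((wallUnit ^ (-pairing n m) : LaurentAwayˣ) : LaurentAway) := by
  simp [wallCrossing, mono, AddMonoidAlgebra.lift_single]

theorem wallCrossing_wallFunction (n : ℕ) :
    wallCrossing n wallFunction = algebraMap Laurent LaurentAway wallFunction := by
  have h : pairing n ![1, 0, 0] = 0 := by simp [pairing]
  change wallCrossing n (1 + mono ![1, 0, 0]) = algebraMap Laurent LaurentAway (1 + mono ![1, 0, 0])
  rw [map_add, map_one, wallCrossing_mono, h]
  simp

theorem val_wallUnit : (wallUnit : LaurentAway) = algebraMap Laurent LaurentAway wallFunction := rfl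

/-- In the second chart `ϑ_q` is `z^q (1 + u)^max(0, ⟨q, (0, -1, n)⟩)`. -/
theorem theta_mem_coordRingV {n : ℕ} {p : NR} (hp : 0 < realPairing n p) (q : N) :
    theta n p q ∈ coordRingV n := by
  rw [theta_eq hp]
  change algebraMap Laurent LaurentAway _ ∈ (wallCrossing n).range
  refine ⟨mono q * wallFunction ^ (pairing n q).toNat, ?_⟩
  change wallCrossing n _ = _
  rw [map_mul, map_pow, map_mul, map_pow, wallCrossing_mono, wallCrossing_wallFunction, mul_assoc,
    ← val_wallUnit]
  congr 1
  rw [← Units.val_pow_eq_pow_val, ← Units.val_pow_eq_pow_val, ← Units.val_mul, ← zpow_natCast,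
    ← zpow_natCast, ← zpow_add]
  congr 2
  unfold crossing
  omega

/-! ### Generation by the theta functions of the distinguished points -/

theorem thetaA_eq {n : ℕ} {p : NR} (hp : 0 < realPairing n p) :
    theta n p (point 0) = mono ![1, 1, 0] * wallFunction := by
  have h : crossing n (point 0) = 1 := by simp [crossing, pairing, point]
  rw [theta_eq hp, h, pow_one]; rfl

theorem thetaB_eq {n : ℕ} {p : NR} (hp : 0 < realPairing n p) :
    theta n p (point 1) = mono ![0, 1, 0] * wallFunction := by
  have h : crossing n (point 1) = 1 := by simp [crossing, pairing, point]
  rw [theta_eq hp, h, pow_one]; rfl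

theorem thetaW_eq {n : ℕ} {p : NR} (hp : 0 < realPairing n p) (i : ℕ) (hi : i ≤ n) :
    theta n p (point (i + 2)) = mono ![(i : ℤ), (i : ℤ), 1] := by
  have h0 : point (i + 2) = ![(i : ℤ), (i : ℤ), 1] := by
    cases i with
    | zero => rfl
    | succ i => simp [point]
  have h : crossing n (point (i + 2)) = 0 := by
    rw [h0]
    simp [crossing, pairing, hi]
  rw [theta_eq hp, h, pow_zero, mul_one, h0]

section Generation
variable {n : ℕ} {G : Subalgebra ℂ Laurent}

theorem mono_mem_of_le (hW : ∀ i ≤ n, mono ![(i : ℤ), (i : ℤ), 1] ∈ G) (c j : ℕ) (hj : j ≤ n * c) :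
    mono ![(j : ℤ), (j : ℤ), (c : ℤ)] ∈ G := by
  induction c generalizing j with
  | zero =>
    obtain rfl : j = 0 := by simpa using hj
    rw [mono_eq_one (by ext i; fin_cases i <;> rfl)]
    exact G.one_mem
  | succ c ih =>
    have hj' : j - min j n ≤ n * c := by rw [mul_add] at hj; omega
    convert G.mul_mem (hW (min j n) (min_le_right _ _)) (ih (j - min j n) hj') using 1
    rw [mono_mul_mono]
    congr 1
    ext i
    fin_cases i <;> simp
    all_goals omega

/-- The monomial `(u²v)^i (uv)^j w^c` is generated: `u²v = ϑ₁ - uv`, and each factor `uv` can be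
absorbed into the part of degree `c` in `w`. -/
theorem mono_mem_right (hA : mono ![1, 1, 0] * wallFunction ∈ G)
    (hW : ∀ i ≤ n, mono ![(i : ℤ), (i : ℤ), 1] ∈ G) (c i j : ℕ) (hj : i + j ≤ n * c) :
    mono ![2 * (i : ℤ) + j, (i : ℤ) + j, (c : ℤ)] ∈ G := by
  induction i generalizing j with
  | zero => simpa using mono_mem_of_le hW c j (by omega)
  | succ i ih =>
    have h := G.sub_mem (G.mul_mem hA (ih j (by omega))) (ih (j + 1) (by omega))
    convert h using 1
    rw [wallFunction, mul_add, mul_one, mono_mul_mono, add_mul, mono_mul_mono, mono_mul_mono,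
      eq_sub_iff_add_eq, add_comm]
    congr 2 <;> ext x <;> fin_cases x <;> simp <;> ring

/-- The monomial `v^i (uv)^j w^c` is generated, since `v = ϑ₂ - uv`. -/
theorem mono_mem_left (hB : mono ![0, 1, 0] * wallFunction ∈ G)
    (hW : ∀ i ≤ n, mono ![(i : ℤ), (i : ℤ), 1] ∈ G) (c i j : ℕ) (hj : i + j ≤ n * c) :
    mono ![(j : ℤ), (i : ℤ) + j, (c : ℤ)] ∈ G := by
  induction i generalizing j with
  | zero => simpa using mono_mem_of_le hW c j (by omega)
  | succ i ih =>
    have h := G.sub_mem (G.mul_mem hB (ih j (by omega))) (ih (j + 1) (by omega))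
    convert h using 1
    rw [wallFunction, mul_add, mul_one, mono_mul_mono, add_mul, mono_mul_mono, mono_mul_mono,
      eq_sub_iff_add_eq]
    congr 2 <;> ext x <;> fin_cases x <;> simp <;> ring

theorem mono_mem_of_le_two_mul (hA : mono ![1, 1, 0] * wallFunction ∈ G)
    (hB : mono ![0, 1, 0] * wallFunction ∈ G)
    (hW : ∀ i ≤ n, mono ![(i : ℤ), (i : ℤ), 1] ∈ G) (a b c : ℕ) (ha : a ≤ 2 * b)
    (hb : b ≤ n * c) : mono ![(a : ℤ), (b : ℤ), (c : ℤ)] ∈ G := by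
  rcases le_total a b with h | h
  · convert mono_mem_left hB hW c (b - a) a (by omega) using 4
    omega
  · convert mono_mem_right hA hW c (a - b) (2 * b - a) (by omega) using 3
    · omega
    · congr 1; omega

/-- The theta functions of points beyond the wall are generated: `u^r (v (1 + u))^e` with `r ≤ e` is
`ϑ₁^r ϑ₂^(e-r)`, and `r` can be chosen so that the cofactor is a monomial in the cone. -/
theorem mono_mul_pow_mem (hA : mono ![1, 1, 0] * wallFunction ∈ G)
    (hB : mono ![0, 1, 0] * wallFunction ∈ G)
    (hW : ∀ i ≤ n, mono ![(i : ℤ), (i : ℤ), 1] ∈ G) (a c e : ℕ) (ha : a ≤ e + 2 * (n * c)) :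
    mono ![(a : ℤ), (n * c + e : ℕ), (c : ℤ)] * wallFunction ^ e ∈ G := by
  rcases le_total a (2 * (n * c)) with h | h
  · convert G.mul_mem (G.pow_mem hB e) (mono_mem_of_le_two_mul hA hB hW a (n * c) c h le_rfl)
      using 1
    rw [mul_pow, mono_pow, mul_right_comm, mono_mul_mono]
    congr 2
    ext x
    fin_cases x <;> simp
    ring
  · obtain ⟨r, rfl⟩ := Nat.exists_eq_add_of_le h
    obtain ⟨s, rfl⟩ := Nat.exists_eq_add_of_le (show r ≤ e by omega)
    convert G.mul_mem (G.mul_mem (G.pow_mem hA r) (G.pow_mem hB s))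
      (mono_mem_of_le_two_mul hA hB hW (2 * (n * c)) (n * c) c le_rfl le_rfl) using 1
    rw [mul_pow, mul_pow, mono_pow, mono_pow, pow_add]
    have : ∀ x y z f g : Laurent, x * f * (y * g) * z = (x * y * z) * (f * g) := by
      intros; ring
    rw [this, mono_mul_mono, mono_mul_mono]
    congr 2
    ext x
    fin_cases x <;> simp <;> ring

end Generation

theorem le_of_toReal_mem_cone {n : ℕ} {q : N} (hq : toReal q ∈ cone n) :
    0 ≤ q 0 ∧ 0 ≤ q 2 ∧ q 0 ≤ 2 * q 1 ∧ q 0 ≤ q 1 + n * q 2 := by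
  obtain ⟨h0, h2, h3, h4⟩ := hq
  simp only [toReal] at h0 h2 h3 h4
  refine ⟨by exact_mod_cast h0, by exact_mod_cast h2, ?_, ?_⟩
  · have : (q 0 : ℝ) ≤ 2 * q 1 := by linarith
    exact_mod_cast this
  · have : (q 0 : ℝ) ≤ q 1 + n * q 2 := by linarith
    exact_mod_cast this

theorem mirrorRing_eq_adjoin {n : ℕ} {p : NR} (hp : 0 < realPairing n p) :
    mirrorRing n p = Algebra.adjoin ℂ (Set.range fun i : Fin (n + 3) => theta n p (point i)) := by
  apply le_antisymm
  · set G := Algebra.adjoin ℂ (Set.range fun i : Fin (n + 3) => theta n p (point i)) with hG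
    have hgen : ∀ i (_ : i < n + 3), theta n p (point i) ∈ G := fun i hi =>
      Algebra.subset_adjoin ⟨⟨i, hi⟩, rfl⟩
    have hA : mono ![1, 1, 0] * wallFunction ∈ G := thetaA_eq hp ▸ hgen 0 (by omega)
    have hB : mono ![0, 1, 0] * wallFunction ∈ G := thetaB_eq hp ▸ hgen 1 (by omega)
    have hW : ∀ i ≤ n, mono ![(i : ℤ), (i : ℤ), 1] ∈ G := fun i hi =>
      thetaW_eq hp i hi ▸ hgen (i + 2) (by omega)
    refine Algebra.adjoin_le ?_
    rintro _ ⟨q, hq, rfl⟩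
    obtain ⟨h0, h2, h3, h4⟩ := le_of_toReal_mem_cone hq
    change theta n p q ∈ G
    rw [theta_eq hp]
    obtain ⟨a, ha⟩ := Int.eq_ofNat_of_zero_le h0
    obtain ⟨b, hb⟩ := Int.eq_ofNat_of_zero_le (show 0 ≤ q 1 by omega)
    obtain ⟨c, hc⟩ := Int.eq_ofNat_of_zero_le h2
    obtain rfl : q = ![(a : ℤ), (b : ℤ), (c : ℤ)] := by
      ext x; fin_cases x <;> assumption
    have h3' : a ≤ 2 * b := by simp at h3; exact_mod_cast h3
    have h4' : a ≤ b + n * c := by simp at h4; exact_mod_cast h4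
    have hcr : crossing n ![(a : ℤ), (b : ℤ), (c : ℤ)] = b - n * c := by
      have h : -pairing n ![(a : ℤ), (b : ℤ), (c : ℤ)] = (b : ℤ) - (n * c : ℕ) := by
        simp [pairing]; ring
      rw [crossing, h]
      omega
    rw [hcr]
    rcases le_total b (n * c) with h | h
    · rw [Nat.sub_eq_zero_of_le h, pow_zero, mul_one]
      exact mono_mem_of_le_two_mul hA hB hW a b c h3' h
    · obtain ⟨e, rfl⟩ := Nat.exists_eq_add_of_le h
      rw [Nat.add_sub_cancel_left]
      exact mono_mul_pow_mem hA hB hW a c e (by omega)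
  · refine Algebra.adjoin_le ?_
    rintro _ ⟨i, rfl⟩
    exact Algebra.subset_adjoin ⟨_, point_mem_cone n i, rfl⟩

/-! ### Normal forms modulo the minors -/

section Scroll
variable {S : Type*} [CommRing S] {n : ℕ} {w : ℕ → S}

theorem mul_eq_mul_of_add_eq (hw : ∀ i < n, ∀ j < n, w i * w (j + 1) = w (i + 1) * w j)
    {i j k l : ℕ} (hi : i ≤ n) (hj : j ≤ n) (hk : k ≤ n) (hl : l ≤ n) (h : i + j = k + l) :
    w i * w j = w k * w l := by
  wlog hik : i ≤ k generalizing i j k l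
  · exact (this hk hl hi hj h.symm (by omega)).symm
  obtain ⟨d, rfl⟩ := Nat.exists_eq_add_of_le hik
  induction d generalizing i j with
  | zero =>
    obtain rfl : j = l := by omega
    rfl
  | succ d ih =>
    obtain ⟨j, rfl⟩ : ∃ j', j = j' + 1 := ⟨j - 1, by omega⟩
    rw [hw i (by omega) j (by omega), ih (i := i + 1) (j := j) (by omega) (by omega) (by omega)
      (by omega) (by omega)]
    congr 2
    omega

/-- The product of `c` of the elements `w 0, …, w n` whose indices add up to `j`, for `j ≤ n * c`.
The large indices are used first. -/
def scrollMonomial (n : ℕ) (w : ℕ → S) : ℕ → ℕ → S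
  | 0, _ => 1
  | c + 1, j => w (min j n) * scrollMonomial n w c (j - min j n)

theorem mul_scrollMonomial (hw : ∀ i < n, ∀ j < n, w i * w (j + 1) = w (i + 1) * w j)
    {i : ℕ} (hi : i ≤ n) (c : ℕ) {j : ℕ} (hj : j ≤ n * c) :
    w i * scrollMonomial n w c j = scrollMonomial n w (c + 1) (i + j) := by
  induction c generalizing i j with
  | zero =>
    obtain rfl : j = 0 := by simpa using hj
    simp [scrollMonomial, hi]
  | succ c ih =>
    rw [mul_add, mul_one] at hj
    rw [scrollMonomial, scrollMonomial, ← mul_assoc,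
      mul_eq_mul_of_add_eq hw hi (min_le_right j n) (min_le_right (i + j) n)
        (show i + min j n - min (i + j) n ≤ n by omega) (by omega), mul_assoc,
      ih (by omega) (by omega)]
    congr 2
    omega

/-- The relation `(A + B) w_{i+1} = A B w_i`, used as a rewriting rule for `A B w_i`. -/
theorem mul_mul_scrollMonomial {A B : S} (hAB : ∀ i < n, (A + B) * w (i + 1) = A * B * w i)
    (hw : ∀ i < n, ∀ j < n, w i * w (j + 1) = w (i + 1) * w j) {c j : ℕ} (hj : j < n * c) :
    A * B * scrollMonomial n w c j = (A + B) * scrollMonomial n w c (j + 1) := by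
  obtain ⟨c, rfl⟩ : ∃ d, c = d + 1 := ⟨c - 1, by
    rcases c with _ | c
    · simp at hj
    · simp⟩
  have hn : 0 < n := by
    rcases Nat.eq_zero_or_pos n with rfl | h
    · simp at hj
    · exact h
  rw [mul_add, mul_one] at hj
  -- write the index as `i + j'` with `i < n`, so that a factor `w i` can be split off
  obtain ⟨i, j', hi, hj', rfl⟩ : ∃ i j', i < n ∧ j' ≤ n * c ∧ j = i + j' := by
    rcases lt_or_ge j n with h | h
    · exact ⟨j, 0, h, by omega, rfl⟩
    · rcases le_total j (n * c) with h' | h'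
      · exact ⟨0, j, hn, h', by omega⟩
      · exact ⟨j - n * c, n * c, by omega, le_rfl, by omega⟩
  rw [← mul_scrollMonomial hw hi.le c hj', ← mul_assoc, ← hAB i hi, mul_assoc,
    mul_scrollMonomial hw hi c hj']
  congr 2
  omega

end Scroll

/-- The exponents `(k, l, c, j)` of the normal forms `A^k B^l ω(c, j)`, where `ω` stands for
`scrollMonomial`. -/
def normalIndex (n : ℕ) : Set (ℕ × ℕ × ℕ × ℕ) :=
  {x | x.2.2.2 ≤ n * x.2.2.1 ∧ (x.2.2.2 = n * x.2.2.1 ∨ x.1 = 0 ∨ x.2.1 = 0)}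

/-- The element `A^k B^l ω(c, j)`. -/
def normalForm {S : Type*} [CommRing S] (n : ℕ) (A B : S) (w : ℕ → S) (x : ℕ × ℕ × ℕ × ℕ) : S :=
  A ^ x.1 * B ^ x.2.1 * scrollMonomial n w x.2.2.1 x.2.2.2

section Span
variable {S : Type*} [CommRing S] [Algebra ℂ S] {n : ℕ} {A B : S} {w : ℕ → S}

/-- Every product `A^k B^l ω(c, j)` reduces to normal forms, by induction on `n * c - j`. -/
theorem normalForm_mem_span (hAB : ∀ i < n, (A + B) * w (i + 1) = A * B * w i)
    (hw : ∀ i < n, ∀ j < n, w i * w (j + 1) = w (i + 1) * w j)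
    (k l c j : ℕ) (hj : j ≤ n * c) :
    normalForm n A B w (k, l, c, j) ∈
      Submodule.span ℂ (Set.range fun x : normalIndex n => normalForm n A B w x) := by
  obtain ⟨d, hd⟩ := Nat.exists_eq_add_of_le hj
  induction d generalizing k l j with
  | zero => exact Submodule.subset_span ⟨⟨(k, l, c, j), hj, Or.inl (by dsimp only; omega)⟩, rfl⟩
  | succ d ih =>
    rcases k with _ | k
    · exact Submodule.subset_span ⟨⟨(0, l, c, j), hj, by simp⟩, rfl⟩
    rcases l with _ | l
    · exact Submodule.subset_span ⟨⟨(k + 1, 0, c, j), hj, by simp⟩, rfl⟩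
    have h : normalForm n A B w (k + 1, l + 1, c, j) =
        normalForm n A B w (k + 1, l, c, j + 1) + normalForm n A B w (k, l + 1, c, j + 1) := by
      have := mul_mul_scrollMonomial hAB hw (show j < n * c by omega)
      simp only [normalForm]
      linear_combination A ^ k * B ^ l * this
    rw [h]
    exact Submodule.add_mem _ (ih _ _ _ (by omega) (by omega)) (ih _ _ _ (by omega) (by omega))

/-- The span of the normal forms contains `1` and is stable under multiplication by the generators,
since the product of `w i` with a `scrollMonomial` is again a `scrollMonomial`. -/
theorem span_normalForm_eq_top (hAB : ∀ i < n, (A + B) * w (i + 1) = A * B * w i)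
    (hw : ∀ i < n, ∀ j < n, w i * w (j + 1) = w (i + 1) * w j)
    (htop : Algebra.adjoin ℂ ({A, B} ∪ w '' Set.Iic n) = ⊤) :
    Submodule.span ℂ (Set.range fun x : normalIndex n => normalForm n A B w x) = ⊤ := by
  set M := Submodule.span ℂ (Set.range fun x : normalIndex n => normalForm n A B w x) with hM
  have hmul : ∀ g ∈ ({A, B} ∪ w '' Set.Iic n : Set S), ∀ y ∈ M, g * y ∈ M := by
    intro g hg y hy
    induction hy using Submodule.span_induction with
    | zero => simp
    | add x y _ _ hx hy => rw [mul_add]; exact M.add_mem hx hy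
    | smul a x _ hx => rw [mul_smul_comm]; exact M.smul_mem a hx
    | mem x hx =>
      obtain ⟨⟨⟨k, l, c, j⟩, hj, -⟩, rfl⟩ := hx
      rcases hg with (rfl | rfl) | ⟨i, hi, rfl⟩
      · convert normalForm_mem_span hAB hw (k + 1) l c j hj using 1
        simp only [normalForm]; ring
      · convert normalForm_mem_span hAB hw k (l + 1) c j hj using 1
        simp only [normalForm]; ring
      · have hi' : i ≤ n := hi
        dsimp only at hj
        convert normalForm_mem_span hAB hw k l (c + 1) (i + j) (by rw [mul_add]; omega) using 1
        simp only [normalForm]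
        rw [← mul_scrollMonomial hw hi' c hj]
        ring
  have hone : (1 : S) ∈ M := by
    convert normalForm_mem_span hAB hw 0 0 0 0 (by simp) using 1
    simp [normalForm, scrollMonomial]
  rw [eq_top_iff]
  rintro x -
  have hx : x ∈ Algebra.adjoin ℂ ({A, B} ∪ w '' Set.Iic n) := htop ▸ Algebra.mem_top
  suffices h : ∀ y ∈ M, x * y ∈ M by simpa using h 1 hone
  induction hx using Algebra.adjoin_induction with
  | mem g hg => exact hmul g hg
  | algebraMap r =>
    intro y hy
    rw [← Algebra.smul_def]
    exact M.smul_mem r hy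
  | add a b _ _ ha hb =>
    intro y hy
    rw [add_mul]
    exact M.add_mem (ha y hy) (hb y hy)
  | mul a b _ _ ha hb =>
    intro y hy
    rw [mul_assoc]
    exact ha _ (hb y hy)

end Span

/-- A family of vectors is linearly independent if it is triangular with respect to a family of
functionals and an `ℕ`-valued rank. -/
theorem linearIndependent_of_triangular {K V ι : Type*} [Field K] [AddCommGroup V] [Module K V]
    (v : ι → V) (f : ι → V →ₗ[K] K) (rank : ι → ℕ) (h1 : ∀ i, f i (v i) ≠ 0)
    (h2 : ∀ i j, j ≠ i → rank j ≤ rank i → f i (v j) = 0) : LinearIndependent K v := by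
  rw [linearIndependent_iff]
  intro l hl
  by_contra hne
  obtain ⟨i, hi, hmax⟩ := l.support.exists_max_image rank (Finsupp.support_nonempty_iff.2 hne)
  have h := congrArg (f i) hl
  rw [Finsupp.linearCombination_apply, Finsupp.sum, map_sum, map_zero,
    Finset.sum_eq_single i] at h
  · rw [map_smul, smul_eq_mul] at h
    exact mul_ne_zero (Finsupp.mem_support_iff.1 hi) (h1 i) h
  · intro j hj hji
    rw [map_smul, h2 i j hji (hmax j hj), smul_zero]
  · exact fun h => absurd hi h

/-- The coefficient of a Laurent polynomial at a given exponent, as a linear functional. -/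
def coeffFunctional (m : N) : Laurent →ₗ[ℂ] ℂ where
  toFun f := f.coeff m
  map_add' _ _ := rfl
  map_smul' _ _ := rfl

theorem scrollMonomial_mono (n c j : ℕ) (hj : j ≤ n * c) :
    scrollMonomial n (fun i => mono ![(i : ℤ), (i : ℤ), 1]) c j =
      mono ![(j : ℤ), (j : ℤ), (c : ℤ)] := by
  induction c generalizing j with
  | zero =>
    obtain rfl : j = 0 := by simpa using hj
    exact (mono_eq_one (by ext i; fin_cases i <;> rfl)).symm
  | succ c ih =>
    have hj' : j - min j n ≤ n * c := by rw [mul_add] at hj; omega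
    rw [scrollMonomial, ih _ hj', mono_mul_mono]
    congr 1
    ext i
    fin_cases i <;> simp
    all_goals omega

theorem normalForm_laurent (n : ℕ) (x : normalIndex n) :
    normalForm n (mono ![1, 1, 0] * wallFunction) (mono ![0, 1, 0] * wallFunction)
        (fun i => mono ![(i : ℤ), (i : ℤ), 1]) x =
      mono ![(x.1.1 + x.1.2.2.2 : ℕ), (x.1.1 + x.1.2.1 + x.1.2.2.2 : ℕ), (x.1.2.2.1 : ℤ)] *
        wallFunction ^ (x.1.1 + x.1.2.1) := by
  obtain ⟨⟨k, l, c, j⟩, hj, -⟩ := x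
  simp only [normalForm]
  rw [scrollMonomial_mono n c j hj, mul_pow, mul_pow, mono_pow, mono_pow, pow_add]
  have : ∀ x y z f g : Laurent, x * f * (y * g) * z = (x * y * z) * (f * g) := by
    intros; ring
  rw [this, mono_mul_mono, mono_mul_mono]
  congr 2
  ext x
  fin_cases x <;> simp

/-- The images of the normal forms in the Laurent ring are triangular. The form with index
`(k, l, c, j)` is `u^(k+j) v^(k+l+j) w^c (1+u)^(k+l)`; it is detected by its highest power of `u`
if `l = 0` or `j = n * c`, and by its lowest power of `u` otherwise. -/
theorem linearIndependent_normalForm (n : ℕ) :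
    LinearIndependent ℂ fun x : normalIndex n =>
      normalForm n (mono ![1, 1, 0] * wallFunction) (mono ![0, 1, 0] * wallFunction)
        (fun i => mono ![(i : ℤ), (i : ℤ), 1]) x := by
  let top (x : normalIndex n) : Prop := x.1.2.1 = 0 ∨ x.1.2.2.2 = n * x.1.2.2.1
  classical
  refine linearIndependent_of_triangular _
    (fun x => coeffFunctional
      ((![(x.1.1 + x.1.2.2.2 : ℕ), (x.1.1 + x.1.2.1 + x.1.2.2.2 : ℕ), (x.1.2.2.1 : ℤ)] : N) +
        (if top x then x.1.1 + x.1.2.1 else 0) • (![1, 0, 0] : N)))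
    (fun x => if top x then x.1.1 else x.1.2.1) ?_ ?_
  · intro x
    rw [normalForm_laurent]
    change (AddMonoidAlgebra.single _ (1 : ℂ) * wallFunction ^ _ : Laurent).coeff _ ≠ 0
    rw [coeff_single_mul_wallFunction_pow_add_smul]
    split_ifs <;> simp
  · intro x y hyx hr
    rw [normalForm_laurent]
    by_contra hne
    change (AddMonoidAlgebra.single _ (1 : ℂ) * wallFunction ^ _ : Laurent).coeff _ ≠ 0 at hne
    obtain ⟨s, hs, h⟩ := exists_of_coeff_single_mul_wallFunction_pow_ne_zero _ _ _ _ hne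
    obtain ⟨⟨k, l, c, j⟩, hj, hx⟩ := x
    obtain ⟨⟨k', l', c', j'⟩, hj', hy⟩ := y
    simp only [top] at h hr
    generalize hM : (if l = 0 ∨ j = n * c then k + l else 0) = M at h
    have h0 := congrFun h 0
    have h1 := congrFun h 1
    have h2 := congrFun h 2
    have hyx' : ¬(k' = k ∧ l' = l ∧ c' = c ∧ j' = j) := by
      rintro ⟨rfl, rfl, rfl, rfl⟩
      exact hyx rfl
    dsimp only at hj hx hj' hy hs
    clear hne h hyx top
    simp at h0 h1 h2
    obtain rfl : c = c' := by omega
    generalize n * c = e at *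
    split_ifs at hM hr <;> omega

/-- A homomorphism to the Laurent ring that maps the generators to the theta functions is
injective if the determinantal relations hold in its source. -/
theorem injective_of_relations {S : Type*} [CommRing S] [Algebra ℂ S] {n : ℕ} {A B : S}
    {w : ℕ → S} (hAB : ∀ i < n, (A + B) * w (i + 1) = A * B * w i)
    (hw : ∀ i < n, ∀ j < n, w i * w (j + 1) = w (i + 1) * w j)
    (htop : Algebra.adjoin ℂ ({A, B} ∪ w '' Set.Iic n) = ⊤) (f : S →ₐ[ℂ] Laurent)
    (hA : f A = mono ![1, 1, 0] * wallFunction) (hB : f B = mono ![0, 1, 0] * wallFunction)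
    (hW : ∀ i, i ≤ n → f (w i) = mono ![(i : ℤ), (i : ℤ), 1]) : Function.Injective f := by
  have hscroll : ∀ c j, j ≤ n * c → f (scrollMonomial n w c j) =
      scrollMonomial n (fun i => mono ![(i : ℤ), (i : ℤ), 1]) c j := by
    intro c
    induction c with
    | zero => intro j _; simp [scrollMonomial]
    | succ c ih =>
      intro j hj
      rw [scrollMonomial, scrollMonomial, map_mul, hW _ (min_le_right _ _), ih]
      rw [mul_add] at hj
      omega
  rw [injective_iff_map_eq_zero]
  intro s hs
  have hmem : s ∈ Submodule.span ℂ (Set.range fun x : normalIndex n => normalForm n A B w x) := by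
    rw [span_normalForm_eq_top hAB hw htop]; trivial
  obtain ⟨l, rfl⟩ := (Finsupp.mem_span_range_iff_exists_finsupp).1 hmem
  suffices l = 0 by simp [this]
  refine linearIndependent_iff.1 (linearIndependent_normalForm n) l ?_
  rw [← hs, Finsupp.linearCombination_apply, Finsupp.sum, Finsupp.sum, map_sum]
  refine Finset.sum_congr rfl fun x _ => ?_
  rw [map_smul]
  congr 1
  simp only [normalForm, map_mul, map_pow, hA, hB]
  rw [hscroll _ _ x.2.1]

/-! ### Homomorphisms out of the polynomial ring -/

section Eval
variable {T : Type*} [CommRing T] [Algebra ℂ T] {n : ℕ}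

/-- The values of the coordinates `ϑ₁, ϑ₂, ϑ₃, ϑ₄, …` as one sequence: `A`, `B`, and then the
sequence `w`. -/
def coordValues (A B : T) (w : ℕ → T) : ℕ → T
  | 0 => A
  | 1 => B
  | i + 2 => w i

/-- The homomorphism out of the coordinate ring of `𝔸^{n+3}` that sends `ϑ₁` to `A`, `ϑ₂` to `B`
and `ϑ_{i+3}` to `w i`. -/
def evalAt (n : ℕ) (A B : T) (w : ℕ → T) : PolyRing n →ₐ[ℂ] T :=
  MvPolynomial.aeval fun i : Fin (n + 3) => coordValues A B w i

/-- The variable `ϑ_{i+3}`, for `i ≤ n`, with the junk value `0` for `i > n`. -/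
def scrollVar (n i : ℕ) : PolyRing n :=
  if h : i ≤ n then MvPolynomial.X ⟨i + 2, by omega⟩ else 0

theorem evalAt_X (A B : T) (w : ℕ → T) (i : Fin (n + 3)) :
    evalAt n A B w (MvPolynomial.X i) = coordValues A B w i := by
  simp [evalAt]

@[simp] theorem evalAt_X_zero (A B : T) (w : ℕ → T) :
    evalAt n A B w (MvPolynomial.X 0) = A := by
  rw [evalAt_X]; rfl

@[simp] theorem evalAt_X_one (A B : T) (w : ℕ → T) :
    evalAt n A B w (MvPolynomial.X 1) = B := by
  rw [evalAt_X]; rfl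

theorem evalAt_scrollVar (A B : T) (w : ℕ → T) {i : ℕ} (hi : i ≤ n) :
    evalAt n A B w (scrollVar n i) = w i := by
  rw [scrollVar, dif_pos hi, evalAt_X]; rfl

theorem algHom_eq_of_generators {f g : PolyRing n →ₐ[ℂ] T}
    (hA : f (MvPolynomial.X 0) = g (MvPolynomial.X 0))
    (hB : f (MvPolynomial.X 1) = g (MvPolynomial.X 1))
    (hW : ∀ i ≤ n, f (scrollVar n i) = g (scrollVar n i)) : f = g := by
  refine MvPolynomial.algHom_ext fun ⟨i, hi⟩ => ?_
  match i, hi with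
  | 0, _ => exact hA
  | 1, _ => exact hB
  | i + 2, hi =>
    have h := hW i (by omega)
    rwa [scrollVar, dif_pos (by omega : i ≤ n)] at h

theorem comp_evalAt {T' : Type*} [CommRing T'] [Algebra ℂ T'] (g : T →ₐ[ℂ] T') (A B : T)
    (w : ℕ → T) : g.comp (evalAt n A B w) = evalAt n (g A) (g B) fun i => g (w i) := by
  refine algHom_eq_of_generators (by simp) (by simp) fun i hi => ?_
  rw [AlgHom.comp_apply, evalAt_scrollVar _ _ _ hi, evalAt_scrollVar _ _ _ hi]

theorem thetaMatrix_zero_succ (j : Fin n) : thetaMatrix n 0 j.succ = scrollVar n j := by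
  rw [scrollVar, dif_pos j.2.le]; rfl

theorem thetaMatrix_one_succ (j : Fin n) : thetaMatrix n 1 j.succ = scrollVar n (j + 1) := by
  rw [scrollVar, dif_pos (Nat.succ_le_of_lt j.2)]; rfl

theorem thetaMatrix_zero_zero :
    thetaMatrix n 0 0 = MvPolynomial.X 0 + MvPolynomial.X 1 := rfl

theorem thetaMatrix_one_zero :
    thetaMatrix n 1 0 = MvPolynomial.X 0 * MvPolynomial.X 1 := rfl

theorem det_submatrix (i j : Fin (n + 1)) : ((thetaMatrix n).submatrix id ![i, j]).det =
    thetaMatrix n 0 i * thetaMatrix n 1 j - thetaMatrix n 0 j * thetaMatrix n 1 i := by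
  simp [Matrix.det_fin_two]

theorem minor_mem (i j : Fin (n + 1)) :
    thetaMatrix n 0 i * thetaMatrix n 1 j - thetaMatrix n 0 j * thetaMatrix n 1 i
      ∈ minorIdeal n := by
  rcases lt_trichotomy i j with h | rfl | h
  · exact Ideal.subset_span ⟨i, j, h, det_submatrix i j⟩
  · simp
  · rw [← neg_mem_iff]
    have h' : thetaMatrix n 0 j * thetaMatrix n 1 i - thetaMatrix n 0 i * thetaMatrix n 1 j
        ∈ minorIdeal n := Ideal.subset_span ⟨j, i, h, det_submatrix j i⟩
    convert h' using 1
    ring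

theorem first_relation_mem {i : ℕ} (hi : i < n) :
    (MvPolynomial.X 0 + MvPolynomial.X 1) * scrollVar n (i + 1) -
      MvPolynomial.X 0 * MvPolynomial.X 1 * scrollVar n i ∈ minorIdeal n := by
  have h := minor_mem (n := n) 0 (Fin.succ ⟨i, hi⟩)
  rw [thetaMatrix_zero_succ, thetaMatrix_one_succ, thetaMatrix_zero_zero,
    thetaMatrix_one_zero] at h
  convert h using 1
  ring

theorem second_relation_mem {i j : ℕ} (hi : i < n) (hj : j < n) :
    scrollVar n i * scrollVar n (j + 1) - scrollVar n (i + 1) * scrollVar n j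
      ∈ minorIdeal n := by
  have h := minor_mem (n := n) (Fin.succ ⟨i, hi⟩) (Fin.succ ⟨j, hj⟩)
  simp only [thetaMatrix_zero_succ, thetaMatrix_one_succ] at h
  convert h using 1
  ring

theorem minorIdeal_le_ker {A B : T} {w : ℕ → T}
    (hAB : ∀ i < n, (A + B) * w (i + 1) = A * B * w i)
    (hw : ∀ i < n, ∀ j < n, w i * w (j + 1) = w (i + 1) * w j) :
    minorIdeal n ≤ RingHom.ker (evalAt n A B w) := by
  rw [minorIdeal, Ideal.span_le]
  rintro _ ⟨i, j, hij, rfl⟩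
  rw [det_submatrix, SetLike.mem_coe, RingHom.mem_ker]
  obtain ⟨j, rfl⟩ := Fin.exists_succ_eq_of_ne_zero (Fin.ne_zero_of_lt hij)
  induction i using Fin.cases with
  | zero =>
    rw [thetaMatrix_zero_succ, thetaMatrix_one_succ, thetaMatrix_zero_zero,
      thetaMatrix_one_zero]
    simp only [map_sub, map_mul, map_add, evalAt_X_zero, evalAt_X_one,
      evalAt_scrollVar A B w j.2.le, evalAt_scrollVar A B w (Nat.succ_le_of_lt j.2)]
    rw [hAB j j.2]
    ring
  | succ i =>
    simp only [thetaMatrix_zero_succ, thetaMatrix_one_succ, map_sub, map_mul,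
      evalAt_scrollVar A B w j.2.le, evalAt_scrollVar A B w (Nat.succ_le_of_lt j.2),
      evalAt_scrollVar A B w i.2.le, evalAt_scrollVar A B w (Nat.succ_le_of_lt i.2)]
    rw [hw i i.2 j j.2]
    ring

end Eval

/-! ### The presentation of the mirror ring -/

section Presentation
variable {n : ℕ} {p : NR}

/-- The homomorphism that sends the variables to the expansions of the theta functions. -/
def laurentHom (n : ℕ) : PolyRing n →ₐ[ℂ] Laurent :=
  evalAt n (mono ![1, 1, 0] * wallFunction) (mono ![0, 1, 0] * wallFunction)
    fun i => mono ![(i : ℤ), (i : ℤ), 1]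

theorem mono_wallFunction_relation (i : ℕ) :
    (mono ![1, 1, 0] * wallFunction + mono ![0, 1, 0] * wallFunction) *
        mono ![((i + 1 : ℕ) : ℤ), ((i + 1 : ℕ) : ℤ), 1] =
      mono ![1, 1, 0] * wallFunction * (mono ![0, 1, 0] * wallFunction) *
        mono ![(i : ℤ), (i : ℤ), 1] := by
  have h1 : (mono ![1, 1, 0] : Laurent) = mono ![1, 0, 0] * mono ![0, 1, 0] := by
    rw [mono_mul_mono]; congr 1; ext x; fin_cases x <;> simp
  have h2 : (mono ![((i + 1 : ℕ) : ℤ), ((i + 1 : ℕ) : ℤ), 1] : Laurent) =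
      mono ![1, 0, 0] * mono ![0, 1, 0] * mono ![(i : ℤ), (i : ℤ), 1] := by
    rw [mono_mul_mono, mono_mul_mono]; congr 1; ext x; fin_cases x <;> simp <;> ring
  rw [h1, h2, wallFunction]
  ring

theorem mono_scroll_relation (i j : ℕ) :
    mono ![(i : ℤ), (i : ℤ), 1] * mono ![((j + 1 : ℕ) : ℤ), ((j + 1 : ℕ) : ℤ), 1] =
      mono ![((i + 1 : ℕ) : ℤ), ((i + 1 : ℕ) : ℤ), 1] * mono ![(j : ℤ), (j : ℤ), 1] := by
  rw [mono_mul_mono, mono_mul_mono]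
  congr 1
  ext x
  fin_cases x <;> simp <;> ring

theorem minorIdeal_le_ker_laurentHom (n : ℕ) :
    minorIdeal n ≤ RingHom.ker (laurentHom n) :=
  minorIdeal_le_ker (fun i _ => mono_wallFunction_relation i) fun i _ j _ =>
    mono_scroll_relation i j

/-- There are no relations between the theta functions other than those given by the minors. -/
theorem ker_laurentHom (n : ℕ) : RingHom.ker (laurentHom n) = minorIdeal n := by
  refine le_antisymm (fun f hf => ?_) (minorIdeal_le_ker_laurentHom n)
  rw [← Ideal.Quotient.eq_zero_iff_mem]
  let π : PolyRing n →ₐ[ℂ] PolyRing n ⧸ minorIdeal n := Ideal.Quotient.mkₐ ℂ (minorIdeal n)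
  have hπ : ∀ x ∈ minorIdeal n, π x = 0 := fun x hx => Ideal.Quotient.eq_zero_iff_mem.2 hx
  let g : PolyRing n ⧸ minorIdeal n →ₐ[ℂ] Laurent :=
    Ideal.Quotient.liftₐ (minorIdeal n) (laurentHom n) fun x hx =>
      minorIdeal_le_ker_laurentHom n hx
  have hg : ∀ x, g (π x) = laurentHom n x := fun x => rfl
  have hinj : Function.Injective g := by
    refine injective_of_relations (n := n) (A := π (MvPolynomial.X 0))
      (B := π (MvPolynomial.X 1)) (w := fun i => π (scrollVar n i)) ?_ ?_ ?_ g ?_ ?_ ?_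
    · intro i hi
      have h := hπ _ (first_relation_mem hi)
      simp only [map_sub, map_mul, map_add] at h
      exact sub_eq_zero.1 h
    · intro i hi j hj
      have h := hπ _ (second_relation_mem hi hj)
      simp only [map_sub, map_mul] at h
      exact sub_eq_zero.1 h
    · have hsurj : Function.Surjective π := Ideal.Quotient.mk_surjective
      rw [eq_top_iff, ← (AlgHom.range_eq_top π).2 hsurj, ← Algebra.map_top,
        ← MvPolynomial.adjoin_range_X, AlgHom.map_adjoin]
      refine Algebra.adjoin_mono ?_
      rintro _ ⟨_, ⟨⟨i, hi⟩, rfl⟩, rfl⟩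
      match i, hi with
      | 0, _ => exact Or.inl (Or.inl rfl)
      | 1, _ => exact Or.inl (Or.inr rfl)
      | i + 2, hi =>
        have hi' : i ≤ n := by omega
        exact Or.inr ⟨i, hi', by simp only [scrollVar, dif_pos hi']⟩
    · rw [hg, laurentHom, evalAt_X_zero]
    · rw [hg, laurentHom, evalAt_X_one]
    · intro i hi
      rw [hg, laurentHom, evalAt_scrollVar _ _ _ hi]
  exact hinj ((hg f).trans (hf.trans (map_zero g).symm))

instance isDomain_laurent : IsDomain Laurent := by
  have : Nontrivial Laurent := AddMonoidAlgebra.instNontrivial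
  exact NoZeroDivisors.to_isDomain _

instance isPrime_minorIdeal (n : ℕ) : (minorIdeal n).IsPrime :=
  ker_laurentHom n ▸ RingHom.ker_isPrime _

theorem val_coordHom (hp : 0 < realPairing n p) (f : PolyRing n) :
    (coordHom n p f : Laurent) = laurentHom n f := by
  have h : (mirrorRing n p).val.comp (coordHom n p) = laurentHom n := by
    refine MvPolynomial.algHom_ext fun ⟨i, hi⟩ => ?_
    rw [AlgHom.comp_apply, coordHom, MvPolynomial.aeval_X, laurentHom, evalAt_X]
    match i, hi with
    | 0, _ => exact thetaA_eq hp
    | 1, _ => exact thetaB_eq hp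
    | i + 2, hi => exact thetaW_eq hp i (by omega)
  exact congrArg (fun g => g f) h

theorem ker_coordHom (hp : 0 < realPairing n p) :
    RingHom.ker (coordHom n p).toRingHom = minorIdeal n := by
  rw [← ker_laurentHom]
  ext f
  rw [RingHom.mem_ker, RingHom.mem_ker, ← val_coordHom hp, ZeroMemClass.coe_eq_zero]
  rfl

theorem coordHom_surjective (hp : 0 < realPairing n p) :
    Function.Surjective (coordHom n p) := by
  rintro ⟨x, hx⟩
  have hx' := hx
  rw [mirrorRing_eq_adjoin hp, Algebra.adjoin_range_eq_range_aeval] at hx'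
  obtain ⟨f, hf⟩ := hx'
  refine ⟨f, Subtype.ext ?_⟩
  refine Eq.trans ?_ hf
  have h : (mirrorRing n p).val.comp (coordHom n p) =
      MvPolynomial.aeval fun i : Fin (n + 3) => theta n p (point i) :=
    MvPolynomial.algHom_ext fun i => by simp [coordHom]
  exact congrArg (fun g => g f) h

/-- The mirror ring is the coordinate ring of the determinantal scheme. -/
def presentation (hp : 0 < realPairing n p) : PolyRing n ⧸ minorIdeal n ≃+* mirrorRing n p :=
  (Ideal.quotEquivOfEq (ker_coordHom hp).symm).trans
    (RingHom.quotientKerEquivOfSurjective (f := (coordHom n p).toRingHom) (coordHom_surjective hp))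

theorem presentation_mk (hp : 0 < realPairing n p) (f : PolyRing n) :
    presentation hp (Ideal.Quotient.mk _ f) = coordHom n p f := rfl

theorem exists_iso (hp : 0 < realPairing n p) : ∃ φ : mirror n p ≅ minorScheme n,
    φ.hom ≫ minorSchemeInclusion n = coordMorphism n p := by
  refine ⟨Scheme.Spec.mapIso (presentation hp).toCommRingCatIso.op, ?_⟩
  change Spec.map _ ≫ Spec.map _ = Spec.map _
  rw [← Spec.map_comp]
  rfl

end Presentation

/-! ### Heights and dimension -/

theorem height_add_ringKrullDim_quotient_le {R : Type*} [CommRing R] (I : Ideal R) [I.IsPrime] :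
    (I.height : WithBot ℕ∞) + ringKrullDim (R ⧸ I) ≤ ringKrullDim R := by
  let x : PrimeSpectrum R := ⟨I, inferInstance⟩
  have hset : PrimeSpectrum.zeroLocus (I : Set R) = Set.Ici x := by
    ext y
    rw [PrimeSpectrum.mem_zeroLocus, Set.mem_Ici, ← PrimeSpectrum.asIdeal_le_asIdeal]
    rfl
  have : Nonempty (PrimeSpectrum R) := ⟨x⟩
  rw [ringKrullDim_quotient, hset, ← Order.coheight_eq_krullDim_Ici,
    show I.height = Order.height x from PrimeSpectrum.height_eq_orderHeight x, ringKrullDim,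
    Order.krullDim_eq_iSup_height_add_coheight_of_nonempty]
  exact_mod_cast le_iSup (fun a : PrimeSpectrum R => Order.height a + Order.coheight a) x

theorem succ_le_height {R : Type*} [CommRing R] {I J : Ideal R} [I.IsPrime] [J.IsPrime]
    (h : I < J) {k : ℕ} (hk : (k : ℕ∞) ≤ I.height) : ((k + 1 : ℕ) : ℕ∞) ≤ J.height := by
  push_cast
  exact (add_le_add_left hk 1).trans (Ideal.height_add_one_le_of_lt_of_isPrime h)

theorem le_ker_comp {R S T : Type*} [CommRing R] [CommRing S] [CommRing T] (f : R →+* S)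
    (g : S →+* T) : RingHom.ker f ≤ RingHom.ker (g.comp f) := fun x hx => by
  rw [RingHom.mem_ker] at *
  rw [RingHom.comp_apply, hx, map_zero]

section Height
variable {n : ℕ}

/-- The substitution `w_i ↦ w_0 t^i` for `i ≤ k`, where `w_1` is used as a name for `t`. Its kernel
is the ideal of the cone over the rational normal curve with coordinates `w_0, …, w_k`. -/
def scrollHom (n k : ℕ) : PolyRing n →ₐ[ℂ] PolyRing n :=
  evalAt n (MvPolynomial.X 0) (MvPolynomial.X 1) fun i =>
    if i ≤ k then scrollVar n 0 * scrollVar n 1 ^ i else scrollVar n i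

theorem ker_scrollHom_lt {k : ℕ} (hk : 1 ≤ k) (hkn : k < n) :
    RingHom.ker (scrollHom n k) < RingHom.ker (scrollHom n (k + 1)) := by
  have hcomp : scrollHom n (k + 1) = (evalAt n (MvPolynomial.X 0) (MvPolynomial.X 1) fun i =>
      if i = k + 1 then scrollVar n 0 * scrollVar n 1 ^ i else scrollVar n i).comp
        (scrollHom n k) := by
    rw [scrollHom, scrollHom, comp_evalAt, evalAt_X_zero, evalAt_X_one]
    refine algHom_eq_of_generators (by simp) (by simp) fun i hi => ?_
    rw [evalAt_scrollVar _ _ _ hi, evalAt_scrollVar _ _ _ hi]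
    rcases le_or_gt i k with h | h
    · rw [if_pos (by omega), if_pos h, map_mul, map_pow, evalAt_scrollVar _ _ _ (by omega),
        evalAt_scrollVar _ _ _ (by omega), if_neg (by omega), if_neg (by omega)]
    · rw [if_neg (not_le.2 h), evalAt_scrollVar _ _ _ hi]
      split_ifs <;> first | rfl | omega
  refine lt_of_le_of_ne ?_ fun heq => ?_
  · rw [hcomp]
    exact le_ker_comp (scrollHom n k).toRingHom _
  have hmem : scrollVar n 0 * scrollVar n (k + 1) - scrollVar n 1 * scrollVar n k ∈
      RingHom.ker (scrollHom n (k + 1)) := by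
    rw [RingHom.mem_ker, scrollHom]
    simp only [map_sub, map_mul]
    rw [evalAt_scrollVar _ _ _ (by omega), evalAt_scrollVar _ _ _ (by omega),
      evalAt_scrollVar _ _ _ (by omega), evalAt_scrollVar _ _ _ (by omega), if_pos (by omega),
      if_pos (by omega), if_pos (by omega), if_pos (by omega)]
    ring
  rw [← heq, RingHom.mem_ker, scrollHom] at hmem
  simp only [map_sub, map_mul] at hmem
  rw [evalAt_scrollVar _ _ _ (by omega), evalAt_scrollVar _ _ _ (by omega),
    evalAt_scrollVar _ _ _ (by omega), evalAt_scrollVar _ _ _ (by omega), if_pos (by omega),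
    if_neg (by omega), if_pos (by omega), if_pos (by omega)] at hmem
  -- evaluate at `w_0 = w_{k+1} = 1`, all other `w_i = 0`
  have h := congrArg (evalAt n (0 : ℂ) 0 fun i => if i = 0 ∨ i = k + 1 then 1 else 0) hmem
  simp only [map_sub, map_mul, map_pow, map_zero] at h
  rw [evalAt_scrollVar _ _ _ (by omega), evalAt_scrollVar _ _ _ (by omega),
    evalAt_scrollVar _ _ _ (by omega)] at h
  have hk0 : ¬ k = 0 := by omega
  simp [hk0] at h

theorem ker_scrollHom_lt_minorIdeal (hn : 1 ≤ n) :
    RingHom.ker (scrollHom n n) < minorIdeal n := by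
  have hcomp : laurentHom n = (evalAt n (mono ![1, 1, 0] * wallFunction)
      (mono ![0, 1, 0] * wallFunction)
      fun i => if i = 0 then mono ![0, 0, 1] else mono ![1, 1, 0]).comp (scrollHom n n) := by
    rw [scrollHom, comp_evalAt, evalAt_X_zero, evalAt_X_one, laurentHom]
    refine algHom_eq_of_generators (by simp) (by simp) fun i hi => ?_
    rw [evalAt_scrollVar _ _ _ hi, evalAt_scrollVar _ _ _ hi, if_pos hi, map_mul, map_pow,
      evalAt_scrollVar _ _ _ (by omega), evalAt_scrollVar _ _ _ (by omega), if_pos rfl,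
      if_neg (by omega), mono_pow, mono_mul_mono]
    congr 1
    ext x
    fin_cases x <;> simp
  refine lt_of_le_of_ne ?_ fun heq => ?_
  · rw [← ker_laurentHom, hcomp]
    exact le_ker_comp (scrollHom n n).toRingHom _
  have hmem := first_relation_mem (n := n) (i := 0) (by omega)
  rw [← heq, RingHom.mem_ker, scrollHom] at hmem
  simp only [map_sub, map_mul, map_add, evalAt_X_zero, evalAt_X_one] at hmem
  rw [evalAt_scrollVar _ _ _ (by omega), evalAt_scrollVar _ _ _ (by omega), if_pos (by omega),
    if_pos (by omega)] at hmem
  -- evaluate at `A = B = w_0 = 1`, `w_1 = 0`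
  have h := congrArg (evalAt n (1 : ℂ) 1 fun i => if i = 0 then 1 else 0) hmem
  simp only [map_sub, map_mul, map_add, map_pow, map_zero, evalAt_X_zero, evalAt_X_one] at h
  rw [evalAt_scrollVar _ _ _ (by omega), evalAt_scrollVar _ _ _ (by omega)] at h
  simp at h

/-- The kernels of the substitutions `scrollHom n k` for `k = 1, …, n`, followed by `minorIdeal n`,
form a chain of `n + 1` prime ideals. -/
theorem le_height_minorIdeal (hn : 1 ≤ n) : (n : ℕ∞) ≤ (minorIdeal n).height := by
  have hprime : ∀ k, (RingHom.ker (scrollHom n k)).IsPrime := fun k => RingHom.ker_isPrime _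
  have hchain : ∀ k, k < n → (k : ℕ∞) ≤ (RingHom.ker (scrollHom n (k + 1))).height := by
    intro k
    induction k with
    | zero => intro _; simp
    | succ k ih => exact fun h => succ_le_height (ker_scrollHom_lt (by omega) h) (ih (by omega))
  obtain ⟨m, rfl⟩ : ∃ m, n = m + 1 := ⟨n - 1, by omega⟩
  exact succ_le_height (ker_scrollHom_lt_minorIdeal hn) (hchain m (by omega))

end Height

section Points
variable {n : ℕ} {p : NR}

/-- The homomorphism out of the mirror ring with given values on the generators, for values that
satisfy the determinantal relations. -/
def mirrorEval (hp : 0 < realPairing n p) {T : Type*} [CommRing T] [Algebra ℂ T] {A B : T}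
    {w : ℕ → T} (hAB : ∀ i < n, (A + B) * w (i + 1) = A * B * w i)
    (hw : ∀ i < n, ∀ j < n, w i * w (j + 1) = w (i + 1) * w j) : mirrorRing n p →+* T :=
  (Ideal.Quotient.lift (minorIdeal n) (evalAt n A B w).toRingHom
    fun _ hx => minorIdeal_le_ker hAB hw hx).comp (presentation hp).symm.toRingHom

theorem mirrorEval_coordHom (hp : 0 < realPairing n p) {T : Type*} [CommRing T] [Algebra ℂ T]
    {A B : T} {w : ℕ → T} (hAB : ∀ i < n, (A + B) * w (i + 1) = A * B * w i)
    (hw : ∀ i < n, ∀ j < n, w i * w (j + 1) = w (i + 1) * w j) (f : PolyRing n) :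
    mirrorEval hp hAB hw (coordHom n p f) = evalAt n A B w f := by
  rw [← presentation_mk hp, mirrorEval, RingHom.comp_apply]
  change Ideal.Quotient.lift _ _ _ ((presentation hp).symm (presentation hp _)) = _
  rw [RingEquiv.symm_apply_apply]
  rfl

theorem ker_mirrorEval_le (hp : 0 < realPairing n p) {T T' : Type*} [CommRing T] [Algebra ℂ T]
    [CommRing T'] [Algebra ℂ T'] {A B : T} {w : ℕ → T} {A' B' : T'} {w' : ℕ → T'}
    (hAB : ∀ i < n, (A + B) * w (i + 1) = A * B * w i)
    (hw : ∀ i < n, ∀ j < n, w i * w (j + 1) = w (i + 1) * w j)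
    (hAB' : ∀ i < n, (A' + B') * w' (i + 1) = A' * B' * w' i)
    (hw' : ∀ i < n, ∀ j < n, w' i * w' (j + 1) = w' (i + 1) * w' j)
    (g : T →ₐ[ℂ] T') (hA : g A = A') (hB : g B = B') (hg : ∀ i ≤ n, g (w i) = w' i) :
    RingHom.ker (mirrorEval hp hAB hw) ≤ RingHom.ker (mirrorEval hp hAB' hw') := by
  intro x hx
  obtain ⟨f, rfl⟩ := coordHom_surjective hp x
  rw [RingHom.mem_ker, mirrorEval_coordHom] at *
  have h : evalAt n A' B' w' = g.comp (evalAt n A B w) := by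
    rw [comp_evalAt]
    refine algHom_eq_of_generators (by simp [hA]) (by simp [hB]) fun i hi => ?_
    rw [evalAt_scrollVar _ _ _ hi, evalAt_scrollVar _ _ _ hi, hg i hi]
  rw [h, AlgHom.comp_apply, hx, map_zero]

/-- The homomorphism from the mirror ring to `ℂ` at the point over the origin of affine space. -/
def vertexEval (hp : 0 < realPairing n p) : mirrorRing n p →+* ℂ :=
  mirrorEval hp (A := (0 : ℂ)) (B := 0) (w := fun _ => 0) (by simp) (by simp)

/-- Restriction of functions to the line `ϑ₁ = ϑ₂ = ϑ₄ = ϑ₅ = … = 0`, with coordinate `ϑ₃`. -/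
def axisEval (hp : 0 < realPairing n p) : mirrorRing n p →+* Polynomial ℂ :=
  mirrorEval hp (A := (0 : Polynomial ℂ)) (B := 0)
    (w := fun i => if i = 0 then Polynomial.X else 0) (by simp) (by
      intro i _ j _
      simp)

instance isPrime_ker_vertexEval (hp : 0 < realPairing n p) :
    (RingHom.ker (vertexEval hp)).IsPrime := RingHom.ker_isPrime _

theorem ker_axisEval_lt (hp : 0 < realPairing n p) :
    RingHom.ker (axisEval hp) < RingHom.ker (vertexEval hp) := by
  refine lt_of_le_of_ne ?_ fun h => ?_
  · refine ker_mirrorEval_le hp _ _ _ _ (Polynomial.aeval (0 : ℂ)) (by simp) (by simp) ?_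
    intro i _
    by_cases hi : i = 0 <;> simp [hi]
  · have hmem : coordHom n p (scrollVar n 0) ∈ RingHom.ker (vertexEval hp) := by
      rw [RingHom.mem_ker, vertexEval, mirrorEval_coordHom, evalAt_scrollVar _ _ _ (by omega)]
    rw [← h, RingHom.mem_ker, axisEval, mirrorEval_coordHom,
      evalAt_scrollVar _ _ _ (by omega), if_pos rfl] at hmem
    exact Polynomial.X_ne_zero hmem

theorem three_le_height_vertex (hp : 0 < realPairing n p) :
    ((3 : ℕ) : ℕ∞) ≤ (RingHom.ker (vertexEval hp)).height := by
  -- the chain of the ideals of the plane `w = 0`, of a line in it, and of the vertex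
  let e₁ : mirrorRing n p →+* PolyRing n :=
    mirrorEval hp (A := (MvPolynomial.X 0 : PolyRing n)) (B := MvPolynomial.X 1)
      (w := fun _ => 0) (by simp) (by simp)
  let e₂ : mirrorRing n p →+* PolyRing n :=
    mirrorEval hp (A := (0 : PolyRing n)) (B := MvPolynomial.X 1)
      (w := fun _ => 0) (by simp) (by simp)
  have h01 : ⊥ < RingHom.ker e₁ := by
    refine lt_of_le_of_ne bot_le fun h => ?_
    have hmem : coordHom n p (scrollVar n 0) ∈ RingHom.ker e₁ := by
      rw [RingHom.mem_ker, mirrorEval_coordHom, evalAt_scrollVar _ _ _ (by omega)]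
    rw [← h, Ideal.mem_bot] at hmem
    have h' := congrArg Subtype.val hmem
    rw [val_coordHom hp, laurentHom, evalAt_scrollVar _ _ _ (by omega)] at h'
    exact AddMonoidAlgebra.single_ne_zero.2 one_ne_zero h'
  have h12 : RingHom.ker e₁ < RingHom.ker e₂ := by
    refine lt_of_le_of_ne (ker_mirrorEval_le hp _ _ _ _
      (evalAt n 0 (MvPolynomial.X 1) fun _ => 0) (by simp) (by simp) (by simp)) fun h => ?_
    have hmem : coordHom n p (MvPolynomial.X 0) ∈ RingHom.ker e₂ := by
      rw [RingHom.mem_ker, mirrorEval_coordHom, evalAt_X_zero]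
    rw [← h, RingHom.mem_ker, mirrorEval_coordHom, evalAt_X_zero] at hmem
    exact MvPolynomial.X_ne_zero _ hmem
  have h23 : RingHom.ker e₂ < RingHom.ker (vertexEval hp) := by
    refine lt_of_le_of_ne (ker_mirrorEval_le hp _ _ _ _
      (evalAt n (0 : ℂ) 0 fun _ => 0) (by simp) (by simp) (by simp)) fun h => ?_
    have hmem : coordHom n p (MvPolynomial.X 1) ∈ RingHom.ker (vertexEval hp) := by
      rw [RingHom.mem_ker, vertexEval, mirrorEval_coordHom, evalAt_X_one]
    rw [← h, RingHom.mem_ker, mirrorEval_coordHom, evalAt_X_one] at hmem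
    exact MvPolynomial.X_ne_zero _ hmem
  have : (⊥ : Ideal (mirrorRing n p)).IsPrime := Ideal.isPrime_bot
  have : (RingHom.ker e₁).IsPrime := RingHom.ker_isPrime _
  have : (RingHom.ker e₂).IsPrime := RingHom.ker_isPrime _
  exact succ_le_height h23 (succ_le_height h12 (succ_le_height h01 (by simp)))

/-- The lower bounds for the height and for the dimension add up to `n + 3`, the dimension of affine
space, so that both are equalities. -/
theorem height_and_dim (hn : 1 ≤ n) (hp : 0 < realPairing n p) :
    (minorIdeal n).height = n ∧ ringKrullDim (mirrorRing n p) = 3 := by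
  have h1 := le_height_minorIdeal hn
  have h2 : ((3 : ℕ) : WithBot ℕ∞) ≤ ringKrullDim (mirrorRing n p) :=
    le_trans (WithBot.coe_le_coe.2 (three_le_height_vertex hp))
      Ideal.height_le_ringKrullDim_of_isPrime
  have h3 := height_add_ringKrullDim_quotient_le (minorIdeal n)
  rw [ringKrullDim_eq_of_ringEquiv (presentation hp),
    MvPolynomial.ringKrullDim_of_isNoetherianRing, ringKrullDim_eq_zero_of_field, zero_add,
    Nat.card_eq_fintype_card, Fintype.card_fin] at h3
  generalize ringKrullDim (mirrorRing n p) = d at *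
  generalize (minorIdeal n).height = e at *
  induction d using WithBot.recBotCoe with
  | bot => simp at h2
  | coe d =>
    have h2' : ((3 : ℕ) : ℕ∞) ≤ d := WithBot.coe_le_coe.1 h2
    have h3' : e + d ≤ ((n + 3 : ℕ) : ℕ∞) := WithBot.coe_le_coe.1 h3
    have he : e ≠ ⊤ := fun h => by
      rw [h, top_add] at h3'
      exact ENat.natCast_ne_top _ (top_le_iff.1 h3')
    have hd : d ≠ ⊤ := fun h => by
      rw [h, add_top] at h3'
      exact ENat.natCast_ne_top _ (top_le_iff.1 h3')
    lift e to ℕ using he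
    lift d to ℕ using hd
    norm_cast at h1 h2' h3'
    constructor
    · have : e = n := by omega
      rw [this]
    · have : d = 3 := by omega
      rw [this]
      rfl

end Points

/-! ### Singular points -/

/-- A prime ideal `𝔭` is singular if there are `d > ht 𝔭` elements of it whose differentials at `𝔭`
are linearly independent. The differentials are read off from a homomorphism to a square-zero
extension of a field `K`, that is, from a `K`-valued point and `d` tangent vectors there. -/
theorem not_isRegularLocalRing_of_tangent {R : Type*} [CommRing R] (𝔭 : Ideal R) [𝔭.IsPrime]
    {K : Type*} [Field K] {d : ℕ} (ψ : R →+* TrivSqZeroExt K (Fin d → K))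
    (hker : ∀ x, x ∈ 𝔭 ↔ (ψ x).fst = 0) (r : Fin d → R)
    (hr : ∀ i, ψ (r i) = TrivSqZeroExt.inr (Pi.single i 1)) (ht : 𝔭.height < d) :
    ¬ IsRegularLocalRing (Localization.AtPrime 𝔭) := by
  intro hreg
  set O := Localization.AtPrime 𝔭
  have hunit : ∀ y : 𝔭.primeCompl, IsUnit (ψ y) := fun y => by
    rw [TrivSqZeroExt.isUnit_iff_isUnit_fst, isUnit_iff_ne_zero]
    exact fun h => y.2 ((hker _).2 h)
  let Ψ : O →+* TrivSqZeroExt K (Fin d → K) := IsLocalization.lift (M := 𝔭.primeCompl) hunit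
  have hΨ : ∀ x, Ψ (algebraMap R O x) = ψ x := IsLocalization.lift_eq hunit
  set m := IsLocalRing.maximalIdeal O
  have hfst : ∀ y ∈ m, (Ψ y).fst = 0 := by
    have hle : m ≤ RingHom.ker ((TrivSqZeroExt.fstHom K K (Fin d → K)).toRingHom.comp Ψ) := by
      rw [show m = _ from (Localization.AtPrime.map_eq_maximalIdeal (I := 𝔭)).symm,
        Ideal.map_le_iff_le_comap]
      intro x hx
      rw [Ideal.mem_comap, RingHom.mem_ker, RingHom.comp_apply, hΨ]
      exact (hker x).1 hx
    exact fun y hy => hle hy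
  have hfg : Submodule.FG m := IsNoetherian.noetherian m
  have hcard : m.generators.ncard < d := by
    have h := hreg.spanFinrank_maximalIdeal
    rw [IsLocalization.AtPrime.ringKrullDim_eq_height 𝔭 O] at h
    rw [hfg.generators_ncard]
    have h' : ((m.spanFinrank : ℕ∞) : WithBot ℕ∞) = (𝔭.height : WithBot ℕ∞) := h
    rw [WithBot.coe_inj] at h'
    rw [← h'] at ht
    exact_mod_cast ht
  have hspan : ∀ y ∈ m,
      (Ψ y).snd ∈ Submodule.span K ((fun y => (Ψ y).snd) '' m.generators) := by
    intro y hy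
    have hy' : y ∈ Submodule.span O m.generators := by rwa [m.span_generators]
    induction hy' using Submodule.span_induction with
    | mem x hx => exact Submodule.subset_span ⟨x, hx, rfl⟩
    | zero => simp
    | add x z hx hz ihx ihz =>
      rw [m.span_generators] at hx hz
      rw [map_add, TrivSqZeroExt.snd_add]
      exact Submodule.add_mem _ (ihx hx) (ihz hz)
    | smul a x hx ihx =>
      rw [m.span_generators] at hx
      rw [smul_eq_mul, map_mul, TrivSqZeroExt.snd_mul, hfst x hx]
      simpa using Submodule.smul_mem _ _ (ihx hx)
  have htop : Submodule.span K ((fun y => (Ψ y).snd) '' m.generators) = ⊤ := by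
    rw [eq_top_iff, ← (Pi.basisFun K (Fin d)).span_eq, Submodule.span_le]
    rintro _ ⟨i, rfl⟩
    have hmem : algebraMap R O (r i) ∈ m := by
      rw [show m = _ from (Localization.AtPrime.map_eq_maximalIdeal (I := 𝔭)).symm]
      refine Ideal.mem_map_of_mem _ ((hker _).2 ?_)
      rw [hr, TrivSqZeroExt.fst_inr]
    have h := hspan _ hmem
    rw [hΨ, hr, TrivSqZeroExt.snd_inr] at h
    simpa using h
  have hfin : m.generators.Finite := hfg.finite_generators
  have : Fintype ((fun y => (Ψ y).snd) '' m.generators) :=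
    (hfin.image fun y => (Ψ y).snd).fintype
  have h := finrank_span_le_card (R := K) ((fun y => (Ψ y).snd) '' m.generators)
  rw [htop, finrank_top, Module.finrank_fin_fun, ← Set.ncard_eq_toFinset_card'] at h
  have h2 := Set.ncard_image_le (f := fun y => (Ψ y).snd) hfin
  omega

section Singular
variable {n : ℕ} {p : NR}

theorem mem_singularLocus_iff (R : CommRingCat.{0}) (x : PrimeSpectrum R) :
    (x : Spec R) ∈ singularLocus (Spec R) ↔
      ¬ IsRegularLocalRing (Localization.AtPrime x.asIdeal) := by
  let k : Algebra R ((Spec R).presheaf.stalk x) := StructureSheaf.stalkAlgebra R x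
  have : IsLocalization.AtPrime ((Spec R).presheaf.stalk x) x.asIdeal :=
    StructureSheaf.IsLocalization.to_stalk R x
  let e : Localization.AtPrime x.asIdeal ≃ₐ[R] (Spec R).presheaf.stalk x :=
    IsLocalization.algEquiv x.asIdeal.primeCompl _ _
  refine not_congr ⟨fun h => ?_, fun h => ?_⟩
  · have h' : IsRegularLocalRing ((Spec R).presheaf.stalk x) := h
    exact IsRegularLocalRing.of_ringEquiv e.symm.toRingEquiv
  · exact IsRegularLocalRing.of_ringEquiv e.toRingEquiv

/-- At the vertex all minors vanish to second order, so that the tangent space is that of affine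
space; the directions of `ϑ₁, ϑ₂, ϑ₃, ϑ₄` suffice. -/
theorem not_isRegularLocalRing_vertex (hn : 1 ≤ n) (hp : 0 < realPairing n p) :
    ¬ IsRegularLocalRing (Localization.AtPrime (RingHom.ker (vertexEval hp))) := by
  let e (i : Fin 4) : TrivSqZeroExt ℂ (Fin 4 → ℂ) := TrivSqZeroExt.inr (Pi.single i 1)
  let w (i : ℕ) : TrivSqZeroExt ℂ (Fin 4 → ℂ) := if i = 0 then e 2 else if i = 1 then e 3 else 0
  have hee : ∀ i j, e i * e j = 0 := fun i j => TrivSqZeroExt.inr_mul_inr _ _ _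
  have hew : ∀ i j, e i * w j = 0 := fun i j => by
    simp only [w]; split_ifs <;> simp [hee]
  have hww : ∀ i j, w i * w j = 0 := fun i j => by
    simp only [w]; split_ifs <;> simp [hee]
  let ψ : mirrorRing n p →+* TrivSqZeroExt ℂ (Fin 4 → ℂ) :=
    mirrorEval hp (A := e 0) (B := e 1) (w := w)
      (fun i _ => by rw [add_mul, hew, hew, hee, zero_mul, add_zero])
      (fun i _ j _ => by rw [hww, hww])
  refine not_isRegularLocalRing_of_tangent _ ψ ?_
    ![coordHom n p (MvPolynomial.X 0), coordHom n p (MvPolynomial.X 1),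
      coordHom n p (scrollVar n 0), coordHom n p (scrollVar n 1)] ?_ ?_
  · intro x
    obtain ⟨f, rfl⟩ := coordHom_surjective hp x
    have h : evalAt n (0 : ℂ) 0 (fun _ => 0) =
        (TrivSqZeroExt.fstHom ℂ ℂ (Fin 4 → ℂ)).comp (evalAt n (e 0) (e 1) w) := by
      rw [comp_evalAt]
      congr 1
      funext i
      simp only [w]
      split_ifs <;> simp [e]
    rw [RingHom.mem_ker, vertexEval, mirrorEval_coordHom, mirrorEval_coordHom, h]
    rfl
  · intro i
    fin_cases i
    · exact (mirrorEval_coordHom _ _ _ _).trans (evalAt_X_zero _ _ _)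
    · exact (mirrorEval_coordHom _ _ _ _).trans (evalAt_X_one _ _ _)
    · exact (mirrorEval_coordHom _ _ _ _).trans (evalAt_scrollVar _ _ _ (by omega))
    · exact (mirrorEval_coordHom _ _ _ _).trans (evalAt_scrollVar _ _ _ hn)
  · have h := Ideal.height_le_ringKrullDim_of_isPrime (I := RingHom.ker (vertexEval hp))
    rw [(height_and_dim hn hp).2] at h
    have h' : (RingHom.ker (vertexEval hp)).height ≤ ((3 : ℕ) : ℕ∞) := WithBot.coe_le_coe.1 h
    exact h'.trans_lt (by norm_num)

instance isPrime_ker_axisEval (hp : 0 < realPairing n p) :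
    (RingHom.ker (axisEval hp)).IsPrime := RingHom.ker_isPrime _

/-- Near a general point of the axis the scheme is the product of a line with the surface
`(ϑ₁ + ϑ₂) t = ϑ₁ ϑ₂`, where `t = ϑ₄ / ϑ₃`; this surface has a node at the origin. So `ϑ₁`, `ϑ₂`
and `ϑ₄` have independent differentials at the generic point of the axis, whose height is `2`. -/
theorem not_isRegularLocalRing_axis (hn : 1 ≤ n) (hp : 0 < realPairing n p) :
    ¬ IsRegularLocalRing (Localization.AtPrime (RingHom.ker (axisEval hp))) := by
  let K := RatFunc ℂ
  let e (i : Fin 3) : TrivSqZeroExt K (Fin 3 → K) := TrivSqZeroExt.inr (Pi.single i 1)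
  let w (i : ℕ) : TrivSqZeroExt K (Fin 3 → K) :=
    if i = 0 then TrivSqZeroExt.inl RatFunc.X else if i = 1 then e 2 else 0
  have hee : ∀ i j, e i * e j = 0 := fun i j => TrivSqZeroExt.inr_mul_inr _ _ _
  have hew : ∀ i j, e i * w (j + 1) = 0 := fun i j => by
    simp only [w, Nat.add_eq_zero_iff, one_ne_zero, and_false, if_false]
    split_ifs <;> simp [hee]
  have hw2 : ∀ j, w (j + 1 + 1) = 0 := fun j => by simp [w]
  have hww : ∀ i j, w (i + 1) * w (j + 1) = 0 := fun i j => by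
    rcases i with _ | i
    · exact hew 2 j
    · rw [hw2, zero_mul]
  let ψ : mirrorRing n p →+* TrivSqZeroExt K (Fin 3 → K) :=
    mirrorEval hp (A := e 0) (B := e 1) (w := w)
      (fun i _ => by rw [add_mul, hew, hew, hee, zero_mul, add_zero])
      (fun i _ j _ => by
        rcases i with _ | i <;> rcases j with _ | j
        · exact mul_comm _ _
        · rw [hww, hw2, mul_zero]
        · rw [hww, hw2, zero_mul]
        · rw [hww, hww])
  refine not_isRegularLocalRing_of_tangent _ ψ ?_
    ![coordHom n p (MvPolynomial.X 0), coordHom n p (MvPolynomial.X 1),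
      coordHom n p (scrollVar n 1)] ?_ ?_
  · intro x
    obtain ⟨f, rfl⟩ := coordHom_surjective hp x
    have h : (IsScalarTower.toAlgHom ℂ (Polynomial ℂ) K).comp
        (evalAt n 0 0 fun i => if i = 0 then Polynomial.X else 0) =
        (TrivSqZeroExt.fstHom ℂ K (Fin 3 → K)).comp (evalAt n (e 0) (e 1) w) := by
      rw [comp_evalAt, comp_evalAt]
      congr 1
      · simp [e]
      · simp [e]
      · funext i
        simp only [w]
        split_ifs <;> simp [e, K]
    have h' := congrArg (fun g => g f) h
    rw [RingHom.mem_ker, axisEval, mirrorEval_coordHom, mirrorEval_coordHom]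
    change _ ↔ TrivSqZeroExt.fstHom ℂ K (Fin 3 → K) _ = 0
    rw [← AlgHom.comp_apply, ← h, AlgHom.comp_apply]
    exact (map_eq_zero_iff _ (RatFunc.algebraMap_injective ℂ)).symm
  · intro i
    fin_cases i
    · exact (mirrorEval_coordHom _ _ _ _).trans (evalAt_X_zero _ _ _)
    · exact (mirrorEval_coordHom _ _ _ _).trans (evalAt_X_one _ _ _)
    · exact (mirrorEval_coordHom _ _ _ _).trans (evalAt_scrollVar _ _ _ hn)
  · have h := Ideal.height_le_ringKrullDim_of_isPrime (I := RingHom.ker (vertexEval hp))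
    rw [(height_and_dim hn hp).2] at h
    have h' : (RingHom.ker (vertexEval hp)).height ≤ ((3 : ℕ) : ℕ∞) := WithBot.coe_le_coe.1 h
    by_contra! h3
    have h4 := succ_le_height (ker_axisEval_lt hp) h3
    exact absurd (h4.trans h') (by norm_num)

/-- The point over the origin is a singular point, and it is a specialisation of the generic point
of the axis, which is another singular point. -/
theorem exists_nonisolated_singular_point (hn : 1 ≤ n) (hp : 0 < realPairing n p) :
    ∃ P : mirror n p, coordMorphism n p P = origin n ∧ P ∈ singularLocus (mirror n p) ∧
      AccPt P (Filter.principal (singularLocus (mirror n p))) := by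
  let P : PrimeSpectrum (mirrorRing n p) := ⟨RingHom.ker (vertexEval hp), inferInstance⟩
  let η : PrimeSpectrum (mirrorRing n p) := ⟨RingHom.ker (axisEval hp), inferInstance⟩
  refine ⟨P, ?_, (mem_singularLocus_iff (CommRingCat.of (mirrorRing n p)) P).2
    (not_isRegularLocalRing_vertex hn hp), ?_⟩
  · refine PrimeSpectrum.ext ?_
    change Ideal.comap (coordHom n p).toRingHom (RingHom.ker (vertexEval hp)) =
      RingHom.ker (MvPolynomial.constantCoeff : PolyRing n →+* ℂ)
    ext f
    have h : evalAt n (0 : ℂ) 0 (fun _ => 0) = MvPolynomial.aeval (fun _ => (0 : ℂ)) := by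
      refine MvPolynomial.algHom_ext fun ⟨i, hi⟩ => ?_
      rw [evalAt_X, MvPolynomial.aeval_X]
      match i, hi with
      | 0, _ => rfl
      | 1, _ => rfl
      | i + 2, _ => rfl
    rw [Ideal.mem_comap, RingHom.mem_ker, RingHom.mem_ker]
    change vertexEval hp (coordHom n p f) = 0 ↔ _
    rw [vertexEval, mirrorEval_coordHom, h]
    simp [MvPolynomial.aeval_zero']
  · refine accPt_iff_nhds.2 fun U hU => ?_
    have hle : η ≤ P := (ker_axisEval_lt hp).le
    have hspec : η ⤳ P := (PrimeSpectrum.le_iff_specializes η P).1 hle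
    refine ⟨η, ⟨mem_of_mem_nhds (hspec hU),
      (mem_singularLocus_iff (CommRingCat.of (mirrorRing n p)) η).2
        (not_isRegularLocalRing_axis hn hp)⟩, fun h => ?_⟩
    exact (ker_axisEval_lt hp).ne (congrArg PrimeSpectrum.asIdeal h)

end Singular

end FlopMirror

end

theorem mainTheorem3 (n : ℕ) (hn : 1 ≤ n) (p : FlopMirror.NR) (hp : p 1 - n * p 2 < 0) :
    (∀ q : FlopMirror.N, Finite (FlopMirror.BrokenLine n p q) ∧
      FlopMirror.theta n p q ∈ FlopMirror.coordRingV n) ∧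
    FlopMirror.mirrorRing n p =
      Algebra.adjoin ℂ (Set.range fun i : Fin (n + 3) =>
        FlopMirror.theta n p (FlopMirror.point i)) ∧
    (∃ φ : FlopMirror.mirror n p ≅ FlopMirror.minorScheme n,
      φ.hom ≫ FlopMirror.minorSchemeInclusion n = FlopMirror.coordMorphism n p) ∧
    (FlopMirror.minorIdeal n).height = n ∧
    IsIntegral (FlopMirror.mirror n p) ∧
    topologicalKrullDim (FlopMirror.mirror n p) = 3 ∧
    ∃ P : FlopMirror.mirror n p,
      FlopMirror.coordMorphism n p P = FlopMirror.origin n ∧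
      P ∈ FlopMirror.singularLocus (FlopMirror.mirror n p) ∧
      AccPt P (Filter.principal (FlopMirror.singularLocus (FlopMirror.mirror n p))) := by
  have hp' : 0 < FlopMirror.realPairing n p := by
    rw [FlopMirror.realPairing]; linarith
  refine ⟨fun q => ⟨FlopMirror.finite_brokenLine hp', FlopMirror.theta_mem_coordRingV hp' q⟩,
    FlopMirror.mirrorRing_eq_adjoin hp', FlopMirror.exists_iso hp',
    (FlopMirror.height_and_dim hn hp').1, ?_, ?_,
    FlopMirror.exists_nonisolated_singular_point hn hp'⟩
  · have : IsDomain (CommRingCat.of (FlopMirror.mirrorRing n p)) :=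
      inferInstanceAs (IsDomain (FlopMirror.mirrorRing n p))
    exact inferInstanceAs (IsIntegral (Spec (CommRingCat.of (FlopMirror.mirrorRing n p))))
  · exact (PrimeSpectrum.topologicalKrullDim_eq_ringKrullDim _).trans
      (FlopMirror.height_and_dim hn hp').2
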